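/- Let $L,m,p,q$ be positive integers and, for $l\in\{1,\dots,L\}$, let $d_l,n_l$ be positive integers; put $N=\sum_{l} n_l$ and $d_{\max}=\max_l d_l$. Let $\mathcal S_l\subset\mathbb R^m$ be a (deterministic) $d_l$-dimensional subspace with orthonormal basis $U^{(l)}\in\mathbb R^{m\times d_l}$ (that is, $U^{(l)}$ has orthonormal columns spanning $\mathcal S_l$), and let $$\mathrm{aff}(\mathcal S_k,\mathcal S_l)=\frac{1}{\sqrt{\min(d_k,d_l)}}\,\bigl\|(U^{(k)})^{T}U^{(l)}\bigr\|_F .$$ Let $a^{(l)}_j$ ($1\le l\le L$, $1\le j\le n_l$) be independent random vectors, $a_j^{(l)}$ uniformly distributed on the unit sphere of $\mathbb R^{d_l}$, and let $\Phi\in\mathbb R^{p\times m}$ be a random matrix, independent of the family of all $a^{(l)}_j$, such that for some constant $\tilde c>0$ $$\mathbb P\bigl(\,\bigl|\|\Phi x\|_2^2-\|x\|_2^2\bigr|\ge t\|x\|_2^2\,\bigr)\le 2e^{-\tilde c t^2p}\qquad\text{for all }x\in\mathbb R^m\setminus\{0\},\ 0<t<1 .$$ The data points are $x^{(l)}_j=\Phi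 U^{(l)}a^{(l)}_j$, and $\mathcal X_l=\{x_j^{(l)}: 1\le j\le n_l\}$ (points are treated as labelled by $(l,j)$). Thresholding-based subspace clustering (TSC) with parameter $q$, applied to the $N$ points $x_1,\dots,x_N$ so obtained, chooses for every $j$ a set $S_j\subset\{1,\dots,N\}\setminus\{j\}$ of cardinality $q$ with $|\langle x_j,x_i\rangle|\ge|\langle x_j,x_k\rangle|$ for all $i\in S_j$ and all $k\notin S_j$, $k\ne j$. It then forms the matrix $Z$ whose $(i,j)$ entry is $\exp\bigl(-2\arccos\bigl(|\langle x_j,x_i\rangle|/(\|x_j\|_2\|x_i\|_2)\bigr)\bigr)$ if $i\in S_j$ and $0$ otherwise, and the graph $G$ with weighted adjacency matrix $A=Z+Z^{T}$. The graph $G$ has no false connections if every point of $\mathcal X_l$ is connected to points of $\mathcal X_l$ only, for all $l$. Theorem. There is a numerical constant $c>1/20$ such that the following holds for all such data. Suppose that $n_l\ge 6q$ for all $l$ and that $$\max_{k\neq l}\ \mathrm{aff}(\mathcal S_k,\mathcal S_l)+\frac{\sqrt{10}}{\sqrt{12\,\tilde c}}\,\frac{\sqrt{d_{\max}}}{\sqrt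 p}\ \le\ \frac{1}{15\log N}.$$ Then, with probability at least $$1-\frac{7}{N}-\sum_{l=1}^{L} n_l\,e^{-c(n_l-1)},$$ the graph $G$ obtained by TSC has no false connections, whatever admissible sets $S_j$ are chosen when there are ties. -/

import Mathlib

open MeasureTheory ProbabilityTheory
open scoped Matrix

namespace SubspaceClustering

noncomputable section

/-- Matrices carry the product (entrywise) Borel sigma-algebra. -/
instance instMeasurableSpaceMatrix {r s : ℕ} : MeasurableSpace (Matrix (Fin r) (Fin s) ℝ) :=
  inferInstanceAs (MeasurableSpace (Fin r → Fin s → ℝ))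

/-- The uniform distribution on the unit sphere of `ℝ^d` (normalised surface measure), regarded as
a measure on `ℝ^d`. For `d ≥ 1` it is a probability measure. -/
def uniformSphere (d : ℕ) : Measure (EuclideanSpace ℝ (Fin d)) :=
  (((volume : Measure (EuclideanSpace ℝ (Fin d))).toSphere Set.univ)⁻¹ •
    (volume : Measure (EuclideanSpace ℝ (Fin d))).toSphere).map Subtype.val

/-- The Frobenius norm of a real matrix. -/
def frobNorm {r s : ℕ} (M : Matrix (Fin r) (Fin s) ℝ) : ℝ :=
  Real.sqrt (∑ i, ∑ j, |M i j| ^ 2)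

/-- The affinity `‖Uᵀ V‖_F / √(min d e)` of the column spans of `U` and `V`, where the columns of
`U` and of `V` are orthonormal bases of a `d`- and an `e`-dimensional subspace of `ℝ^m`. -/
def affinity {m d e : ℕ} (U : Matrix (Fin m) (Fin d) ℝ) (V : Matrix (Fin m) (Fin e) ℝ) : ℝ :=
  1 / Real.sqrt ((min d e : ℕ) : ℝ) * frobNorm (Uᵀ * V)

/-- The concentration (Johnson-Lindenstrauss) property with constant `c` of a random matrix `Φ`
with `p` rows. Nonzero `x` only: for `x = 0` the event is the whole space. -/
def HasJLProperty {Ω : Type*} [MeasurableSpace Ω] {p m : ℕ} (μ : Measure Ω)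
    (Φ : Ω → Matrix (Fin p) (Fin m) ℝ) (c : ℝ) : Prop :=
  ∀ x : EuclideanSpace ℝ (Fin m), x ≠ 0 → ∀ t : ℝ, 0 < t → t < 1 →
    μ.real {ω | t * ‖x‖ ^ 2 ≤ |‖Matrix.toEuclideanLin (Φ ω) x‖ ^ 2 - ‖x‖ ^ 2|}
      ≤ 2 * Real.exp (-c * t ^ 2 * (p : ℝ))

section TSC

variable {ι : Type*} [Fintype ι] [DecidableEq ι] {p : ℕ}

/-- `S j` is an admissible choice, for every `j`, of `q` nearest neighbours of `x j` among the
other points, nearness being measured by `|⟪x j, x i⟫|`; ties may be broken arbitrarily. -/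
def IsTSCSelection (q : ℕ) (x : ι → EuclideanSpace ℝ (Fin p)) (S : ι → Finset ι) : Prop :=
  ∀ j, j ∉ S j ∧ (S j).card = q ∧
    ∀ i ∈ S j, ∀ k, k ≠ j → k ∉ S j → |inner ℝ (x j) (x k)| ≤ |inner ℝ (x j) (x i)|

/-- The matrix `Z` of TSC, whose `j`-th column is the weight vector `z_j` of the point `x j`. -/
def tscZ (x : ι → EuclideanSpace ℝ (Fin p)) (S : ι → Finset ι) : Matrix ι ι ℝ :=
  Matrix.of fun i j => if i ∈ S j then
    Real.exp (-2 * Real.arccos (|inner ℝ (x j) (x i)| / (‖x j‖ * ‖x i‖))) else 0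

/-- The adjacency matrix `A = Z + Zᵀ` of TSC. -/
def tscAdjacency (x : ι → EuclideanSpace ℝ (Fin p)) (S : ι → Finset ι) : Matrix ι ι ℝ :=
  tscZ x S + (tscZ x S)ᵀ

/-- The graph whose edges are the nonzero off-diagonal entries of a (symmetric) weighted adjacency
matrix. -/
def graphOfAdjacency (A : Matrix ι ι ℝ) : SimpleGraph ι :=
  SimpleGraph.fromRel fun i j => A i j ≠ 0

/-- No false connections: adjacent vertices carry the same cluster label. -/
def NoFalseConnections {κ : Type*} (G : SimpleGraph ι) (label : ι → κ) : Prop :=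
  ∀ i j, G.Adj i j → label i = label j

end TSC

/-- The projected data points `x_j^(l) = Φ U^(l) a_j^(l)`, indexed by the pairs `⟨l, j⟩`. -/
def projectedData {L m p : ℕ} {d n : Fin L → ℕ} (U : ∀ l, Matrix (Fin m) (Fin (d l)) ℝ)
    (Φ : Matrix (Fin p) (Fin m) ℝ)
    (a : ∀ i : (Σ l : Fin L, Fin (n l)), EuclideanSpace ℝ (Fin (d i.1)))
    (i : Σ l : Fin L, Fin (n l)) : EuclideanSpace ℝ (Fin p) :=
  Matrix.toEuclideanLin Φ (Matrix.toEuclideanLin (U i.1) (a i))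

end

end SubspaceClustering

open SubspaceClustering

namespace SubspaceClustering

/-! For a point `j` of cluster `l`, write `T = Φ U^(l)` and `v = Tᵀ T a_j`, so that `⟪x_j, x_r⟫ =
⟪v, a_r⟫` for every `r` in the same cluster. It suffices that, for each `j`, at least `q` such
correlations strictly exceed all correlations with other clusters; a false neighbour would then
force more than `q` points into `S_j`.

Large true correlations: conditionally on `Φ` and `a_j`, the other `a_r` are independent and uniform
on the sphere. A small-ball bound says each satisfies `⟪v, a_r⟫² ≥ ‖v‖² / (6 d_l)` with probability
at least 1/3, and Chernoff makes this happen for more than a sixth of them, up to probability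
`exp(-(n_l - 1)/18)`. Moreover `‖v‖ ≥ ⟪v, a_j⟫ = ‖x_j‖² ≥ 3/4` with high probability.

Small false correlations: before projection, `⟪U^(l) a_j, U^(k) a_i⟫` is a bilinear form in
independent uniform vectors, with exponential tail at scale `‖(U^(k))ᵀ U^(l)‖_F / √(d_k d_l)`;
projection changes it little, by polarizing the concentration property. The affinity hypothesis
bounds `√d_l` times the projected correlation by 4/15, whereas a good true correlation gives at
least `(3/4)/√6`.

Both sphere estimates come from `E exp(s d ⟪u, a⟫²) ≤ 1/√(1 - 2s)` for unit `u` and `s < 1/2`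
(`lintegral_uniformSphere_exp_inner_sq_le`): a positive `s` gives the tails, a negative `s` the
small-ball bound. A union bound over points and pairs finishes. -/

/-! ### Square-exponential moments and small-ball bounds on the sphere. -/

theorem lintegral_polar {E : Type*} [NormedAddCommGroup E] [NormedSpace ℝ E] [MeasurableSpace E]
    [BorelSpace E] [FiniteDimensional ℝ E] [Nontrivial E] (μ : Measure E) [μ.IsAddHaarMeasure]
    {F : E → ENNReal} (hF : Measurable F) :
    ∫⁻ x, F x ∂μ = ∫⁻ s : Metric.sphere (0 : E) 1,
      (∫⁻ r : Set.Ioi (0 : ℝ), F (r.1 • s.1) ∂(Measure.volumeIoiPow (Module.finrank ℝ E - 1)))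
        ∂μ.toSphere := by
  have hmp := μ.measurePreserving_homeomorphUnitSphereProd
  have h1 : ∫⁻ x, F x ∂μ = ∫⁻ x : ({(0)}ᶜ : Set E), F x.1 ∂(μ.comap (↑)) := by
    rw [lintegral_subtype_comap (measurableSet_singleton _).compl, restrict_compl_singleton]
  have hm : Measurable fun z : Metric.sphere (0 : E) 1 × Set.Ioi (0 : ℝ) => F (z.2.1 • z.1.1) :=
    hF.comp (Continuous.measurable (by fun_prop))
  rw [h1, ← lintegral_prod _ hm.aemeasurable, ← hmp.lintegral_comp hm]
  refine lintegral_congr fun x => ?_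
  congr 1
  have hx : ‖x.1‖ ≠ 0 := norm_ne_zero_iff.2 x.2
  simp [smul_smul, hx]

/-- The integral of a Gaussian weight tilted in one direction. -/
theorem lintegral_exp_neg_sq_add_inner_sq {d : ℕ} {u : EuclideanSpace ℝ (Fin d)} (hu : ‖u‖ = 1)
    {s : ℝ} (hs : s < 1 / 2) :
    ∫⁻ x : EuclideanSpace ℝ (Fin d),
        ENNReal.ofReal (Real.exp (-(1 / 2) * ‖x‖ ^ 2 + s * inner ℝ u x ^ 2)) =
      ENNReal.ofReal (Real.sqrt (Real.pi / (1 / 2 - s)) *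
        Real.sqrt (Real.pi / (1 / 2)) ^ (d - 1)) := by
  obtain _ | k := d
  · simp [Subsingleton.elim u 0] at hu
  have horth : Orthonormal ℝ (({0} : Set (Fin (k + 1))).domRestrict fun _ => u) := by
    -- Completing `u` to an orthonormal basis makes the integrand a product of one-dimensional
    -- Gaussians, of which only the coordinate along `u` is tilted.
    refine ⟨fun i => hu, fun i j hij => absurd (Subsingleton.elim i j) hij⟩
  obtain ⟨b, hb⟩ := horth.exists_orthonormalBasis_extension_of_card_eq (by simp)
  have hb0 : b 0 = u := hb 0 rfl
  have hmeas : Measurable fun x : EuclideanSpace ℝ (Fin (k + 1)) =>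
      ENNReal.ofReal (Real.exp (-(1 / 2) * ‖x‖ ^ 2 + s * inner ℝ u x ^ 2)) := by fun_prop
  rw [← (b.measurePreserving_repr_symm.comp
    (PiLp.volume_preserving_toLp (Fin (k + 1)))).lintegral_comp hmeas]
  simp only [Function.comp_apply]
  let f : Fin (k + 1) → ℝ → ℝ := fun i t => Real.exp (-(if i = 0 then 1 / 2 - s else 1 / 2) * t ^ 2)
  have hpos : ∀ i : Fin (k + 1), 0 < (if i = 0 then 1 / 2 - s else (1 / 2 : ℝ)) := by
    intro i; split_ifs <;> linarith
  have hf : ∀ i, Integrable (f i) := fun i => integrable_exp_neg_mul_sq (hpos i)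
  have key : ∀ y : Fin (k + 1) → ℝ,
      Real.exp (-(1 / 2) * ‖b.repr.symm (WithLp.toLp 2 y)‖ ^ 2 +
        s * inner ℝ u (b.repr.symm (WithLp.toLp 2 y)) ^ 2) = ∏ i, f i (y i) := by
    intro y
    rw [LinearIsometryEquiv.norm_map, EuclideanSpace.norm_sq_eq, ← hb0, ← b.repr_apply_apply,
      LinearIsometryEquiv.apply_symm_apply, ← Real.exp_sum]
    congr 1
    simp only [Real.norm_eq_abs, sq_abs, Fin.sum_univ_succ, if_true, Fin.succ_ne_zero, if_false,
      ← Finset.mul_sum]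
    ring
  simp_rw [key]
  rw [← ofReal_integral_eq_lintegral_ofReal]
  · rw [integral_fintype_prod_volume_eq_prod]
    simp only [f, Fin.prod_univ_succ, integral_gaussian, if_true, Fin.succ_ne_zero, if_false,
      Finset.prod_const, Finset.card_univ, Fintype.card_fin, Nat.add_sub_cancel]
  · exact Integrable.fintype_prod hf
  · exact Filter.Eventually.of_forall fun y => Finset.prod_nonneg fun i _ => (Real.exp_pos _).le

theorem lintegral_volumeIoiPow (k : ℕ) {F : ℝ → ENNReal} :
    ∫⁻ r : Set.Ioi (0 : ℝ), F r.1 ∂(Measure.volumeIoiPow k) =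
      ∫⁻ r in Set.Ioi (0 : ℝ), ENNReal.ofReal (r ^ k) * F r := by
  rw [Measure.volumeIoiPow, lintegral_withDensity_eq_lintegral_mul_non_measurable]
  · simp only [Pi.mul_apply]
    rw [lintegral_subtype_comap measurableSet_Ioi fun r : ℝ => ENNReal.ofReal (r ^ k) * F r]
  · fun_prop
  · simp

theorem lintegral_volumeIoiPow_gaussian {d : ℕ} (hd : 1 ≤ d) {b : ℝ} (hb : 0 < b) :
    ∫⁻ r : Set.Ioi (0 : ℝ), ENNReal.ofReal (Real.exp (-b * r.1 ^ 2))
        ∂(Measure.volumeIoiPow (d - 1)) =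
      ENNReal.ofReal (b ^ (-(d : ℝ) / 2) * (1 / 2) * Real.Gamma ((d : ℝ) / 2)) := by
  rw [lintegral_volumeIoiPow (F := fun r => ENNReal.ofReal (Real.exp (-b * r ^ 2)))]
  have hd' : ((d - 1 : ℕ) : ℝ) = (d : ℝ) - 1 := by push_cast [hd]; ring
  have hd0 : (1 : ℝ) ≤ d := by exact_mod_cast hd
  have hq : -1 < (d : ℝ) - 1 := by linarith
  have h1 : ∀ r ∈ Set.Ioi (0 : ℝ), ENNReal.ofReal (r ^ (d - 1)) *
      ENNReal.ofReal (Real.exp (-b * r ^ 2)) =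
      ENNReal.ofReal (r ^ ((d : ℝ) - 1) * Real.exp (-b * r ^ 2)) := by
    intro r hr
    have hr : 0 < r := hr
    rw [← ENNReal.ofReal_mul (by positivity), ← hd', Real.rpow_natCast]
  rw [setLIntegral_congr_fun measurableSet_Ioi h1, ← ofReal_integral_eq_lintegral_ofReal]
  · have := integral_rpow_mul_exp_neg_mul_rpow (p := 2) (q := (d : ℝ) - 1) two_pos hq hb
    simp only [Real.rpow_two, sub_add_cancel] at this
    rw [this]
  · exact integrableOn_rpow_mul_exp_neg_mul_sq hb hq
  · filter_upwards [ae_restrict_mem measurableSet_Ioi] with r hr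
    have hr : 0 < r := hr
    positivity

/-- The one-dimensional marginals of the uniform distribution on the sphere of radius `√d` have
Gaussian square-exponential moments. -/
theorem lintegral_toSphere_exp_inner_sq_le {d : ℕ} {u : EuclideanSpace ℝ (Fin d)} (hu : ‖u‖ = 1)
    {s : ℝ} (hs : s < 1 / 2) :
    ∫⁻ x : Metric.sphere (0 : EuclideanSpace ℝ (Fin d)) 1,
        ENNReal.ofReal (Real.exp (s * d * inner ℝ u x.1 ^ 2))
        ∂(volume : Measure (EuclideanSpace ℝ (Fin d))).toSphere ≤
      ENNReal.ofReal (1 / Real.sqrt (1 - 2 * s)) *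
        (volume : Measure (EuclideanSpace ℝ (Fin d))).toSphere Set.univ := by
  have hd : 1 ≤ d := by
    by_contra h
    obtain rfl : d = 0 := by omega
    simp [Subsingleton.elim u 0] at hu
  have : Nontrivial (EuclideanSpace ℝ (Fin d)) := ⟨u, 0, by rintro rfl; simp at hu⟩
  set σ := (volume : Measure (EuclideanSpace ℝ (Fin d))).toSphere
  set C : ENNReal := ENNReal.ofReal ((1 / 2) ^ (-(d : ℝ) / 2) * (1 / 2) * Real.Gamma ((d : ℝ) / 2))
  have hdpos : (0 : ℝ) < d := by exact_mod_cast hd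
  have hΓ : 0 < Real.Gamma ((d : ℝ) / 2) := Real.Gamma_pos_of_pos (by positivity)
  have hC0 : C ≠ 0 := by
    simp only [C, ne_eq, ENNReal.ofReal_eq_zero, not_le]
    positivity
  have hCtop : C ≠ ⊤ := ENNReal.ofReal_ne_top
  have hquad : ∀ {t : ℝ} {x : EuclideanSpace ℝ (Fin d)}, t < 1 / 2 → ‖x‖ = 1 →
      0 < 1 / 2 - t * inner ℝ u x ^ 2 := by
    intro t x ht hx
    have h1 : inner ℝ u x ^ 2 ≤ 1 := by
      rw [sq_le_one_iff_abs_le_one]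
      simpa [hu, hx] using abs_real_inner_le_norm u x
    rcases le_total t 0 with h0 | h0 <;> nlinarith [sq_nonneg (inner ℝ u x)]
  -- Integrating the tilted Gaussian along each ray turns it into the power `-d/2` of the quadratic
  -- factor on the sphere.
  have hpolar : ∀ t : ℝ, t < 1 / 2 → ∫⁻ x : Metric.sphere (0 : EuclideanSpace ℝ (Fin d)) 1,
      ENNReal.ofReal ((1 / 2 - t * inner ℝ u x.1 ^ 2) ^ (-(d : ℝ) / 2) * (1 / 2) *
        Real.Gamma ((d : ℝ) / 2)) ∂σ = ENNReal.ofReal (Real.sqrt (Real.pi / (1 / 2 - t)) *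
        Real.sqrt (Real.pi / (1 / 2)) ^ (d - 1)) := by
    intro t ht
    rw [← lintegral_exp_neg_sq_add_inner_sq hu ht, lintegral_polar volume (by fun_prop)]
    refine lintegral_congr fun x => ?_
    have hx : ‖x.1‖ = 1 := by simp
    rw [finrank_euclideanSpace_fin, ← lintegral_volumeIoiPow_gaussian hd (hquad ht hx)]
    refine lintegral_congr fun r => ?_
    rw [norm_smul, inner_smul_right, hx, Real.norm_eq_abs, mul_one, sq_abs]
    congr 2
    ring
  -- The untilted case `t = 0` normalises the total mass, so the area of the sphere is never
  -- computed.
  have hC : C * σ Set.univ = ENNReal.ofReal (Real.sqrt (Real.pi / (1 / 2)) ^ d) := by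
    have h0 := hpolar 0 (by norm_num)
    simp only [zero_mul, sub_zero, lintegral_const] at h0
    rw [h0, ← pow_succ', Nat.sub_add_cancel hd]
  -- From `1 - 2y ≤ exp(-2y)`: raising to the negative power `-d/2` reverses the inequality and
  -- produces `exp(d y)`, whatever the sign of `s`.
  have hlow : ∀ x : Metric.sphere (0 : EuclideanSpace ℝ (Fin d)) 1,
      C * ENNReal.ofReal (Real.exp (s * d * inner ℝ u x.1 ^ 2)) ≤
        ENNReal.ofReal ((1 / 2 - s * inner ℝ u x.1 ^ 2) ^ (-(d : ℝ) / 2) * (1 / 2) *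
          Real.Gamma ((d : ℝ) / 2)) := by
    intro x
    have hx : ‖x.1‖ = 1 := by simp
    have hq := hquad hs hx
    rw [← ENNReal.ofReal_mul (by positivity)]
    refine ENNReal.ofReal_le_ofReal ?_
    set y := s * inner ℝ u x.1 ^ 2
    have h1 : 1 / 2 - y ≤ 1 / 2 * Real.exp (-2 * y) := by
      have := Real.add_one_le_exp (-2 * y)
      linarith
    have h2 : (1 / 2 * Real.exp (-2 * y)) ^ (-(d : ℝ) / 2) ≤ (1 / 2 - y) ^ (-(d : ℝ) / 2) :=
      Real.rpow_le_rpow_of_nonpos hq h1 (by linarith)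
    have h3 : (1 / 2 * Real.exp (-2 * y)) ^ (-(d : ℝ) / 2) =
        (1 / 2) ^ (-(d : ℝ) / 2) * Real.exp (s * d * inner ℝ u x.1 ^ 2) := by
      rw [Real.mul_rpow (by norm_num) (Real.exp_pos _).le, ← Real.exp_mul]
      congr 2
      simp only [y]
      ring
    rw [h3] at h2
    calc _ = (1 / 2) ^ (-(d : ℝ) / 2) * Real.exp (s * d * inner ℝ u x.1 ^ 2) * (1 / 2) *
          Real.Gamma ((d : ℝ) / 2) := by ring
      _ ≤ _ := by gcongr
  have hsq : Real.sqrt (Real.pi / (1 / 2 - s)) =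
      1 / Real.sqrt (1 - 2 * s) * Real.sqrt (Real.pi / (1 / 2)) := by
    have hs' : 0 < 1 - 2 * s := by linarith
    rw [show 1 / Real.sqrt (1 - 2 * s) = Real.sqrt (1 / (1 - 2 * s)) by simp,
      ← Real.sqrt_mul (div_nonneg zero_le_one hs'.le)]
    congr 1
    have : 1 - 2 * s ≠ 0 := by linarith
    have : 1 / 2 - s ≠ 0 := by linarith
    field_simp
  have hmain : C * ∫⁻ x : Metric.sphere (0 : EuclideanSpace ℝ (Fin d)) 1,
      ENNReal.ofReal (Real.exp (s * d * inner ℝ u x.1 ^ 2)) ∂σ ≤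
      C * (ENNReal.ofReal (1 / Real.sqrt (1 - 2 * s)) * σ Set.univ) := by
    rw [← lintegral_const_mul _ (by fun_prop)]
    refine (lintegral_mono hlow).trans ?_
    rw [hpolar s hs, mul_left_comm, hC, hsq, ← ENNReal.ofReal_mul (by positivity), mul_assoc,
      ← pow_succ', Nat.sub_add_cancel hd]
  exact (ENNReal.mul_le_mul_iff_right hC0 hCtop).1 hmain

theorem toSphere_univ_ne_zero {d : ℕ} (hd : 1 ≤ d) :
    (volume : Measure (EuclideanSpace ℝ (Fin d))).toSphere Set.univ ≠ 0 := by
  have : NeZero d := ⟨by omega⟩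
  rw [Ne, Measure.measure_univ_eq_zero, Measure.toSphere_eq_zero_iff_finrank]
  simp; omega

theorem lintegral_uniformSphere {d : ℕ} {F : EuclideanSpace ℝ (Fin d) → ENNReal}
    (hF : Measurable F) :
    ∫⁻ x, F x ∂uniformSphere d =
      ((volume : Measure (EuclideanSpace ℝ (Fin d))).toSphere Set.univ)⁻¹ *
        ∫⁻ x : Metric.sphere (0 : EuclideanSpace ℝ (Fin d)) 1, F x.1
          ∂(volume : Measure (EuclideanSpace ℝ (Fin d))).toSphere := by
  rw [uniformSphere, lintegral_map hF measurable_subtype_coe, lintegral_smul_measure, smul_eq_mul]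

theorem isProbabilityMeasure_uniformSphere {d : ℕ} (hd : 1 ≤ d) :
    IsProbabilityMeasure (uniformSphere d) := by
  refine ⟨?_⟩
  rw [← lintegral_one, lintegral_uniformSphere measurable_const, lintegral_one,
    ENNReal.inv_mul_cancel (toSphere_univ_ne_zero hd) (measure_ne_top _ _)]

theorem ae_uniformSphere_norm (d : ℕ) : ∀ᵐ x ∂uniformSphere d, ‖x‖ = 1 := by
  rw [uniformSphere, ae_map_iff measurable_subtype_coe.aemeasurable
    (measurableSet_eq_fun measurable_norm measurable_const)]
  exact Filter.Eventually.of_forall fun x => by simp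

theorem lintegral_uniformSphere_exp_inner_sq_le {d : ℕ} (hd : 1 ≤ d)
    {u : EuclideanSpace ℝ (Fin d)} (hu : ‖u‖ = 1) {s : ℝ} (hs : s < 1 / 2) :
    ∫⁻ x, ENNReal.ofReal (Real.exp (s * d * inner ℝ u x ^ 2)) ∂uniformSphere d ≤
      ENNReal.ofReal (1 / Real.sqrt (1 - 2 * s)) := by
  rw [lintegral_uniformSphere (by fun_prop)]
  refine (mul_le_mul_right (lintegral_toSphere_exp_inner_sq_le hu hs) _).trans ?_
  rw [mul_left_comm, ENNReal.inv_mul_cancel (toSphere_univ_ne_zero hd) (measure_ne_top _ _),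
    mul_one]

/-- The choice `s = 3/8` makes `1/√(1 - 2s)` equal to 2. For `v = 0` the quotient reads 0 and the
integral is 1. -/
theorem lintegral_uniformSphere_exp_inner_sq_div_le_two {d : ℕ} (hd : 1 ≤ d)
    (v : EuclideanSpace ℝ (Fin d)) :
    ∫⁻ x, ENNReal.ofReal (Real.exp (3 / 8 * (d * inner ℝ v x ^ 2 / ‖v‖ ^ 2))) ∂uniformSphere d
      ≤ 2 := by
  have := isProbabilityMeasure_uniformSphere hd
  by_cases hv : v = 0
  · simp [hv]
  have hv' : ‖v‖ ≠ 0 := norm_ne_zero_iff.2 hv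
  have hu : ‖(‖v‖⁻¹ • v)‖ = 1 := by simp [norm_smul, hv']
  have h := lintegral_uniformSphere_exp_inner_sq_le hd hu (s := 3 / 8) (by norm_num)
  have h2 : 1 / Real.sqrt (1 - 2 * (3 / 8)) = 2 := by
    rw [show (1 - 2 * (3 / 8) : ℝ) = (1 / 2) ^ 2 by norm_num, Real.sqrt_sq (by norm_num)]
    norm_num
  rw [h2, ENNReal.ofReal_ofNat] at h
  refine le_trans (le_of_eq (lintegral_congr fun x => ?_)) h
  rw [real_inner_smul_left, mul_pow, inv_pow]
  congr 2
  ring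

/-- Small-ball estimate for the marginals of the uniform distribution on the sphere. -/
theorem uniformSphere_inner_sq_lt_le {d : ℕ} (hd : 1 ≤ d) (v : EuclideanSpace ℝ (Fin d)) :
    uniformSphere d {x | 6 * d * inner ℝ v x ^ 2 < ‖v‖ ^ 2} ≤ ENNReal.ofReal (2 / 3) := by
  by_cases hv : v = 0
  · simp [hv]
  have hv' : ‖v‖ ≠ 0 := norm_ne_zero_iff.2 hv
  have hu : ‖(‖v‖⁻¹ • v)‖ = 1 := by simp [norm_smul, hv']
  -- Markov's inequality with `s = -4`: the moment is at most 1/3, and on the event the exponent is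
  -- at least `-4/6`, which costs a factor `exp(2/3) ≤ 2`.
  have h := lintegral_uniformSphere_exp_inner_sq_le hd hu (s := -4) (by norm_num)
  have h3 : 1 / Real.sqrt (1 - 2 * (-4)) = 1 / 3 := by
    rw [show (1 - 2 * (-4) : ℝ) = 3 ^ 2 by norm_num, Real.sqrt_sq (by norm_num)]
  rw [h3] at h
  have hexp : Real.exp (2 / 3) ≤ 2 := by
    rw [← Real.le_log_iff_exp_le two_pos]
    linarith [Real.log_two_gt_d9]
  calc uniformSphere d {x | 6 * d * inner ℝ v x ^ 2 < ‖v‖ ^ 2}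
      ≤ ∫⁻ x, ENNReal.ofReal (Real.exp (2 / 3)) *
          ENNReal.ofReal (Real.exp (-4 * d * inner ℝ (‖v‖⁻¹ • v) x ^ 2)) ∂uniformSphere d := by
        refine meas_le_lintegral₀ (by fun_prop) fun x hx => ?_
        have hx : 6 * d * inner ℝ v x ^ 2 < ‖v‖ ^ 2 := hx
        rw [← ENNReal.ofReal_mul (Real.exp_pos _).le, ← Real.exp_add, ENNReal.one_le_ofReal,
          Real.one_le_exp_iff, real_inner_smul_left, mul_pow, inv_pow]
        have : (d : ℝ) * ((‖v‖ ^ 2)⁻¹ * inner ℝ v x ^ 2) ≤ 1 / 6 := by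
          rw [← mul_assoc, mul_comm (d : ℝ), mul_assoc, inv_mul_le_iff₀ (by positivity)]
          linarith
        linarith
    _ ≤ ENNReal.ofReal 2 * ENNReal.ofReal (1 / 3) := by
        rw [lintegral_const_mul _ (by fun_prop)]
        gcongr
    _ = ENNReal.ofReal (2 / 3) := by
        rw [← ENNReal.ofReal_mul two_pos.le]
        norm_num

/-! ### Tails of bilinear forms in two uniform vectors. -/

theorem frobNorm_sq {r s : ℕ} (M : Matrix (Fin r) (Fin s) ℝ) :
    frobNorm M ^ 2 = ∑ i, ‖(WithLp.toLp 2 (M i) : EuclideanSpace ℝ (Fin s))‖ ^ 2 := by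
  rw [frobNorm, Real.sq_sqrt (by positivity)]
  simp [EuclideanSpace.norm_sq_eq]

theorem frobNorm_nonneg {r s : ℕ} (M : Matrix (Fin r) (Fin s) ℝ) : 0 ≤ frobNorm M :=
  Real.sqrt_nonneg _

theorem toEuclideanLin_apply_eq_inner {r s : ℕ} (M : Matrix (Fin r) (Fin s) ℝ)
    (x : EuclideanSpace ℝ (Fin s)) (i : Fin r) :
    Matrix.toEuclideanLin M x i = inner ℝ (WithLp.toLp 2 (M i) : EuclideanSpace ℝ (Fin s)) x := by
  simp [Matrix.toLpLin_apply, Matrix.mulVec, dotProduct, PiLp.inner_apply, mul_comm]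

/-- Square-exponential moment of a linear image of a uniform vector on the sphere, by convexity
over the rows of the matrix. -/
theorem lintegral_uniformSphere_exp_norm_sq_le_two {d e : ℕ} (hd : 1 ≤ d)
    (M : Matrix (Fin e) (Fin d) ℝ) :
    ∫⁻ x, ENNReal.ofReal (Real.exp (3 / 8 *
      (d * ‖Matrix.toEuclideanLin M x‖ ^ 2 / frobNorm M ^ 2))) ∂uniformSphere d ≤ 2 := by
  have := isProbabilityMeasure_uniformSphere hd
  by_cases hM : frobNorm M = 0
  · simp [hM]
  have hF : 0 < frobNorm M ^ 2 := by positivity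
  let m : Fin e → EuclideanSpace ℝ (Fin d) := fun i => WithLp.toLp 2 (M i)
  -- The weights sum to 1, so the normalised square norm is a convex combination of the normalised
  -- squares of the row marginals, and Jensen's inequality for `exp` applies.
  let w : Fin e → ℝ := fun i => ‖m i‖ ^ 2 / frobNorm M ^ 2
  have hw : ∀ i, 0 ≤ w i := fun i => by positivity
  have hw1 : ∑ i, w i = 1 := by
    rw [← Finset.sum_div, ← frobNorm_sq, div_self hF.ne']
  have hpt : ∀ x : EuclideanSpace ℝ (Fin d),
      Real.exp (3 / 8 * (d * ‖Matrix.toEuclideanLin M x‖ ^ 2 / frobNorm M ^ 2)) ≤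
        ∑ i, w i * Real.exp (3 / 8 * (d * inner ℝ (m i) x ^ 2 / ‖m i‖ ^ 2)) := by
    intro x
    have hj := convexOn_exp.map_sum_le (t := Finset.univ) (w := w)
      (p := fun i => 3 / 8 * (d * inner ℝ (m i) x ^ 2 / ‖m i‖ ^ 2)) (fun i _ => hw i) hw1
      (fun i _ => Set.mem_univ _)
    simp only [smul_eq_mul] at hj
    refine le_trans (le_of_eq ?_) hj
    congr 1
    rw [EuclideanSpace.norm_sq_eq, Finset.mul_sum, Finset.sum_div, Finset.mul_sum]
    refine Finset.sum_congr rfl fun i _ => ?_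
    rw [toEuclideanLin_apply_eq_inner, Real.norm_eq_abs, sq_abs]
    change 3 / 8 * (d * inner ℝ (m i) x ^ 2 / frobNorm M ^ 2) =
      ‖m i‖ ^ 2 / frobNorm M ^ 2 * (3 / 8 * (d * inner ℝ (m i) x ^ 2 / ‖m i‖ ^ 2))
    by_cases hi : m i = 0
    · simp [hi]
    have hi' : ‖m i‖ ≠ 0 := norm_ne_zero_iff.2 hi
    field_simp
  calc _ ≤ ∫⁻ x, ∑ i, ENNReal.ofReal (w i) *
        ENNReal.ofReal (Real.exp (3 / 8 * (d * inner ℝ (m i) x ^ 2 / ‖m i‖ ^ 2)))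
          ∂uniformSphere d := by
        refine lintegral_mono fun x => ?_
        refine (ENNReal.ofReal_le_ofReal (hpt x)).trans (le_of_eq ?_)
        rw [ENNReal.ofReal_sum_of_nonneg fun i _ => mul_nonneg (hw i) (Real.exp_pos _).le]
        exact Finset.sum_congr rfl fun i _ => ENNReal.ofReal_mul (hw i)
    _ = ∑ i, ENNReal.ofReal (w i) * ∫⁻ x, ENNReal.ofReal
          (Real.exp (3 / 8 * (d * inner ℝ (m i) x ^ 2 / ‖m i‖ ^ 2))) ∂uniformSphere d := by
        rw [lintegral_finsetSum _ fun i _ => by fun_prop]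
        exact Finset.sum_congr rfl fun i _ => lintegral_const_mul _ (by fun_prop)
    _ ≤ ∑ i, ENNReal.ofReal (w i) * 2 := by
        gcongr
        exact lintegral_uniformSphere_exp_inner_sq_div_le_two hd _
    _ = 2 := by
        rw [← Finset.sum_mul, ← ENNReal.ofReal_sum_of_nonneg fun i _ => hw i, hw1]
        simp

/-- Tail of the bilinear form `⟪M a, b⟫` in two independent uniform vectors on spheres. -/
theorem uniformSphere_prod_inner_gt_le {d e : ℕ} (hd : 1 ≤ d) (he : 1 ≤ e)
    (M : Matrix (Fin e) (Fin d) ℝ) (x : ℝ) (hx : 0 ≤ x) :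
    (uniformSphere d).prod (uniformSphere e) {z | x * frobNorm M <
      Real.sqrt d * Real.sqrt e * |inner ℝ (Matrix.toEuclideanLin M z.1) z.2|} ≤
      ENNReal.ofReal (4 * Real.exp (-(3 / 4 * x))) := by
  have := isProbabilityMeasure_uniformSphere hd
  have := isProbabilityMeasure_uniformSphere he
  have hMc : Continuous (Matrix.toEuclideanLin M) := LinearMap.continuous_of_finiteDimensional _
  have hMm : Measurable (Matrix.toEuclideanLin M) := hMc.measurable
  have hmeas : MeasurableSet {z : EuclideanSpace ℝ (Fin d) × EuclideanSpace ℝ (Fin e) |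
      x * frobNorm M < Real.sqrt d * Real.sqrt e *
        |inner ℝ (Matrix.toEuclideanLin M z.1) z.2|} :=
    (isOpen_lt continuous_const (by fun_prop)).measurableSet
  rw [Measure.prod_apply hmeas]
  have hin : ∀ a : EuclideanSpace ℝ (Fin d), uniformSphere e (Prod.mk a ⁻¹' {z | x * frobNorm M <
      Real.sqrt d * Real.sqrt e * |inner ℝ (Matrix.toEuclideanLin M z.1) z.2|}) ≤
      ENNReal.ofReal (Real.exp (-(3 / 4 * x))) * ENNReal.ofReal (Real.exp (3 / 8 *
      (d * ‖Matrix.toEuclideanLin M a‖ ^ 2 / frobNorm M ^ 2))) * 2 := by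
    intro a
    set v := Matrix.toEuclideanLin M a
    refine le_trans ?_ (mul_le_mul_right (lintegral_uniformSphere_exp_inner_sq_div_le_two he v) _)
    rw [← lintegral_const_mul _ (by fun_prop)]
    refine meas_le_lintegral₀ (by fun_prop) fun b hb => ?_
    have hb : x * frobNorm M < Real.sqrt d * Real.sqrt e * |inner ℝ v b| := hb
    have hv : v ≠ 0 := by
      rintro h0
      rw [h0] at hb
      simp only [inner_zero_left, abs_zero, mul_zero] at hb
      exact absurd hb (not_lt.2 (mul_nonneg hx (frobNorm_nonneg M)))
    have hF : 0 < frobNorm M := by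
      refine lt_of_le_of_ne (frobNorm_nonneg M) fun h0 => hv ?_
      have hsum := frobNorm_sq M
      rw [← h0, zero_pow two_ne_zero, eq_comm, Finset.sum_eq_zero_iff_of_nonneg
        fun i _ => by positivity] at hsum
      ext i
      have := hsum i (Finset.mem_univ i)
      rw [sq_eq_zero_iff, norm_eq_zero] at this
      simp [v, toEuclideanLin_apply_eq_inner, this]
    have hvn : 0 < ‖v‖ := norm_pos_iff.2 hv
    rw [← ENNReal.ofReal_mul (Real.exp_pos _).le, ← Real.exp_add,
      ← ENNReal.ofReal_mul (Real.exp_pos _).le, ← Real.exp_add, ENNReal.one_le_ofReal,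
      Real.one_le_exp_iff]
    set A := Real.sqrt d * ‖v‖ / frobNorm M
    set B := Real.sqrt e * |inner ℝ v b| / ‖v‖
    have hA : d * ‖v‖ ^ 2 / frobNorm M ^ 2 = A ^ 2 := by
      simp only [A, div_pow, mul_pow]
      rw [Real.sq_sqrt (Nat.cast_nonneg _)]
    have hB : e * inner ℝ v b ^ 2 / ‖v‖ ^ 2 = B ^ 2 := by
      simp only [B, div_pow, mul_pow]
      rw [Real.sq_sqrt (Nat.cast_nonneg _), sq_abs]
    have hAB : x ≤ A * B := by
      have : A * B = Real.sqrt d * Real.sqrt e * |inner ℝ v b| / frobNorm M := by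
        simp only [A, B]; field_simp
      rw [this, le_div_iff₀ hF]
      exact hb.le
    rw [hA, hB]
    -- By AM-GM, `(3/8)(A² + B²) ≥ (3/4) A B ≥ (3/4) x`. The two square-exponential moments, each at
    -- most 2, give the prefactor 4.
    nlinarith [sq_nonneg (A - B)]
  refine (lintegral_mono hin).trans ?_
  rw [lintegral_mul_const _ (by fun_prop), lintegral_const_mul _ (by fun_prop)]
  calc _ ≤ ENNReal.ofReal (Real.exp (-(3 / 4 * x))) * 2 * 2 := by
        gcongr
        exact lintegral_uniformSphere_exp_norm_sq_le_two hd M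
    _ = _ := by
        rw [← ENNReal.ofReal_ofNat 2, ← ENNReal.ofReal_mul (by positivity),
          ← ENNReal.ofReal_mul (by positivity)]
        congr 1
        ring

/-! ### Freezing one of two independent variables, and measurability of matrix actions. -/

/-- If `X` and `Y` are independent, a bound on the probability of an event for every frozen value
of `X` holds unconditionally. -/
theorem measure_le_of_indepFun {Ω α β : Type*} [MeasurableSpace Ω] [MeasurableSpace α]
    [MeasurableSpace β] {μ : Measure Ω} [IsProbabilityMeasure μ] {X : Ω → α} {Y : Ω → β}
    (hX : Measurable X) (hY : Measurable Y) (h : IndepFun X Y μ) {B : Set (α × β)}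
    (hB : MeasurableSet B) {C : ENNReal}
    (hC : ∀ᵐ x ∂μ.map X, μ {ω | (x, Y ω) ∈ B} ≤ C) : μ {ω | (X ω, Y ω) ∈ B} ≤ C := by
  have := Measure.isProbabilityMeasure_map (μ := μ) hX.aemeasurable
  have := Measure.isProbabilityMeasure_map (μ := μ) hY.aemeasurable
  have h1 : μ {ω | (X ω, Y ω) ∈ B} = μ.map (fun ω => (X ω, Y ω)) B :=
    (Measure.map_apply (hX.prodMk hY) hB).symm
  rw [h1, h.map_prod_eq_prod_map_map hX.aemeasurable hY.aemeasurable, Measure.prod_apply hB]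
  refine (lintegral_mono_ae (g := fun _ => C) ?_).trans (by simp)
  filter_upwards [hC] with x hx
  rwa [Measure.map_apply hY (measurable_prodMk_left hB)]

theorem measurable_matrix_entry {α : Type*} [MeasurableSpace α] {r s : ℕ}
    {A : α → Matrix (Fin r) (Fin s) ℝ} (hA : Measurable A) (i : Fin r) (j : Fin s) :
    Measurable fun z => A z i j :=
  (measurable_pi_apply (X := fun _ : Fin s => ℝ) j).comp
    ((measurable_pi_apply (X := fun _ : Fin r => Fin s → ℝ) i).comp hA)

theorem measurable_matrix_of_entry {α : Type*} [MeasurableSpace α] {r s : ℕ}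
    {A : α → Matrix (Fin r) (Fin s) ℝ} (hA : ∀ i j, Measurable fun z => A z i j) : Measurable A :=
  measurable_pi_lambda (X := fun _ : Fin r => Fin s → ℝ) _ fun i =>
    measurable_pi_lambda (X := fun _ : Fin s => ℝ) _ fun j => hA i j

theorem measurable_toEuclideanLin {α : Type*} [MeasurableSpace α] {r s : ℕ}
    {A : α → Matrix (Fin r) (Fin s) ℝ} (hA : Measurable A) {x : α → EuclideanSpace ℝ (Fin s)}
    (hx : Measurable x) : Measurable fun z => Matrix.toEuclideanLin (A z) (x z) := by
  refine (WithLp.measurable_toLp 2 (Fin r → ℝ)).comp (measurable_pi_lambda _ fun i => ?_)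
  change Measurable fun z => ∑ j, A z i j * x z j
  refine Finset.measurable_sum _ fun j _ => (measurable_matrix_entry hA i j).mul ?_
  exact (measurable_pi_apply j).comp ((WithLp.measurable_ofLp 2 (Fin s → ℝ)).comp hx)

/-! ### Consequences of the concentration property for fixed vectors. -/

section JL

variable {Ω : Type*} [MeasurableSpace Ω] {p m : ℕ} {μ : Measure Ω} [IsProbabilityMeasure μ]
  {Φ : Ω → Matrix (Fin p) (Fin m) ℝ} {c : ℝ}

theorem HasJLProperty.measure_le (h : HasJLProperty μ Φ c) {x : EuclideanSpace ℝ (Fin m)}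
    (hx : x ≠ 0) {t : ℝ} (ht : 0 < t) (ht1 : t < 1) :
    μ {ω | t * ‖x‖ ^ 2 ≤ |‖Matrix.toEuclideanLin (Φ ω) x‖ ^ 2 - ‖x‖ ^ 2|} ≤
      ENNReal.ofReal (2 * Real.exp (-c * t ^ 2 * p)) := by
  rw [ENNReal.le_ofReal_iff_toReal_le (measure_ne_top _ _) (by positivity)]
  exact h x hx t ht ht1

theorem HasJLProperty.measure_norm_sq_lt_le (h : HasJLProperty μ Φ c)
    {x : EuclideanSpace ℝ (Fin m)} (hx : ‖x‖ = 1) {t : ℝ} (ht : 0 < t) (ht1 : t < 1) :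
    μ {ω | ‖Matrix.toEuclideanLin (Φ ω) x‖ ^ 2 < 1 - t} ≤
      ENNReal.ofReal (2 * Real.exp (-c * t ^ 2 * p)) := by
  refine (measure_mono fun ω hω => ?_).trans
    (h.measure_le (x := x) (by rintro rfl; simp at hx) ht ht1)
  have hω : ‖Matrix.toEuclideanLin (Φ ω) x‖ ^ 2 < 1 - t := hω
  simp only [Set.mem_ofPred_eq, hx]
  rw [abs_sub_comm]
  refine le_trans ?_ (le_abs_self _)
  linarith

/-- The strict inequality makes the event empty at `x = 0`, so that polarization needs no case
distinction when `x + y` or `x - y` vanishes. -/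
theorem HasJLProperty.measure_norm_sq_gt_le (h : HasJLProperty μ Φ c)
    (x : EuclideanSpace ℝ (Fin m)) {t : ℝ} (ht : 0 < t) (ht1 : t < 1) :
    μ {ω | t * ‖x‖ ^ 2 < |‖Matrix.toEuclideanLin (Φ ω) x‖ ^ 2 - ‖x‖ ^ 2|} ≤
      ENNReal.ofReal (2 * Real.exp (-c * t ^ 2 * p)) := by
  by_cases hx : x = 0
  · simp [hx]
  · exact (measure_mono fun ω hω => le_of_lt (show t * ‖x‖ ^ 2 < _ from hω)).trans
      (h.measure_le hx ht ht1)

/-- Approximate preservation of inner products, by polarization. -/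
theorem HasJLProperty.measure_inner_gt_le (h : HasJLProperty μ Φ c)
    {x y : EuclideanSpace ℝ (Fin m)} (hx : ‖x‖ = 1) (hy : ‖y‖ = 1) {t : ℝ} (ht : 0 < t)
    (ht1 : t < 1) :
    μ {ω | t < |inner ℝ (Matrix.toEuclideanLin (Φ ω) x) (Matrix.toEuclideanLin (Φ ω) y) -
      inner ℝ x y|} ≤ ENNReal.ofReal (4 * Real.exp (-c * t ^ 2 * p)) := by
  have hsub : {ω | t < |inner ℝ (Matrix.toEuclideanLin (Φ ω) x) (Matrix.toEuclideanLin (Φ ω) y) -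
      inner ℝ x y|} ⊆
      {ω | t * ‖x + y‖ ^ 2 <
        |‖Matrix.toEuclideanLin (Φ ω) (x + y)‖ ^ 2 - ‖x + y‖ ^ 2|} ∪
      {ω | t * ‖x - y‖ ^ 2 <
        |‖Matrix.toEuclideanLin (Φ ω) (x - y)‖ ^ 2 - ‖x - y‖ ^ 2|} := by
    intro ω hω
    by_contra hcon
    simp only [Set.mem_union, Set.mem_ofPred_eq, not_or, not_lt, map_add, map_sub] at hcon hω
    set X := Matrix.toEuclideanLin (Φ ω) x
    set Y := Matrix.toEuclideanLin (Φ ω) y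
    obtain ⟨h1, h2⟩ := hcon
    -- For unit vectors `‖x + y‖² + ‖x - y‖² = 4`, so the two errors add up to at most `4t`, while
    -- polarization divides by 4.
    rw [norm_add_sq_real, norm_add_sq_real, hx, hy] at h1
    rw [norm_sub_sq_real, norm_sub_sq_real, hx, hy] at h2
    rw [abs_le] at h1 h2
    refine absurd hω (not_lt.2 (abs_le.2 ⟨?_, ?_⟩)) <;> linarith
  refine (measure_mono hsub).trans ((measure_union_le _ _).trans ?_)
  refine (add_le_add (h.measure_norm_sq_gt_le _ ht ht1) (h.measure_norm_sq_gt_le _ ht ht1)).trans ?_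
  rw [← ENNReal.ofReal_add (by positivity) (by positivity)]
  exact ENNReal.ofReal_le_ofReal (by linarith)

end JL

/-! ### A Chernoff bound for the number of well correlated points. -/

section Counting

variable {Ω : Type*} [MeasurableSpace Ω] {μ : Measure Ω} {d : ℕ}

/-- The number of entries of `y` whose correlation with `v` is at least `‖v‖ / √(6d)`. -/
noncomputable def goodCount {κ : Type*} [Fintype κ] (v : EuclideanSpace ℝ (Fin d))
    (y : κ → EuclideanSpace ℝ (Fin d)) : ℕ :=
  ∑ r, if ‖v‖ ^ 2 ≤ 6 * d * inner ℝ v (y r) ^ 2 then 1 else 0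

theorem measurable_goodCount {α κ : Type*} [MeasurableSpace α] [Fintype κ]
    {v : α → EuclideanSpace ℝ (Fin d)} (hv : Measurable v)
    {y : α → κ → EuclideanSpace ℝ (Fin d)} (hy : Measurable y) :
    Measurable fun z => goodCount (v z) (y z) := by
  refine Finset.measurable_sum _ fun r _ => Measurable.ite ?_ measurable_const measurable_const
  have hr : Measurable fun z => y z r := (measurable_pi_apply r).comp hy
  exact measurableSet_le (by fun_prop) (by fun_prop)

/-- A failure probability of at most 2/3 bounds the moment by `2/3 + e⁻¹/3 ≤ 0.79`, while
`exp(-2/9)` is about 0.80. The rate 2/9 is chosen to exceed 1/6 by 1/18. -/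
theorem lintegral_uniformSphere_exp_neg_indicator_le (hd : 1 ≤ d)
    (v : EuclideanSpace ℝ (Fin d)) :
    ∫⁻ x, ENNReal.ofReal (Real.exp
      (-((if ‖v‖ ^ 2 ≤ 6 * d * inner ℝ v x ^ 2 then 1 else 0 : ℕ) : ℝ))) ∂uniformSphere d ≤
      ENNReal.ofReal (Real.exp (-(2 / 9))) := by
  have := isProbabilityMeasure_uniformSphere hd
  have hS : MeasurableSet {x : EuclideanSpace ℝ (Fin d) | 6 * d * inner ℝ v x ^ 2 < ‖v‖ ^ 2} :=
    measurableSet_lt (by fun_prop) (by fun_prop)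
  have he0 := Real.exp_pos (-1)
  have he1 : Real.exp (-1) ≤ 37 / 100 := by
    rw [Real.exp_neg, inv_le_comm₀ (Real.exp_pos _) (by norm_num)]
    linarith [Real.exp_one_gt_d9]
  have he2 : 79 / 100 ≤ Real.exp (-(2 / 9)) := by
    have h9 : Real.exp (-(2 / 9)) ^ 9 = (Real.exp 1)⁻¹ ^ 2 := by
      rw [← Real.exp_nat_mul, ← Real.exp_neg, ← Real.exp_nat_mul]
      norm_num
    refine le_of_pow_le_pow_left₀ (n := 9) (by norm_num) (Real.exp_pos _).le ?_
    rw [h9]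
    have : (36 / 100 : ℝ) ≤ (Real.exp 1)⁻¹ := by
      rw [le_inv_comm₀ (by norm_num) (Real.exp_pos _)]
      linarith [Real.exp_one_lt_d9]
    refine le_trans ?_ (pow_le_pow_left₀ (by norm_num) this 2)
    norm_num
  calc _ = ∫⁻ x, ENNReal.ofReal (Real.exp (-1)) + ENNReal.ofReal (1 - Real.exp (-1)) *
        Set.indicator {x | 6 * d * inner ℝ v x ^ 2 < ‖v‖ ^ 2} 1 x ∂uniformSphere d := by
        refine lintegral_congr fun x => ?_
        by_cases hx : ‖v‖ ^ 2 ≤ 6 * d * inner ℝ v x ^ 2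
        · simp [hx]
        · rw [Set.indicator_of_mem (by simpa using hx), if_neg hx]
          simp only [Pi.one_apply, mul_one]
          rw [← ENNReal.ofReal_add he0.le (by linarith)]
          simp
    _ = ENNReal.ofReal (Real.exp (-1)) + ENNReal.ofReal (1 - Real.exp (-1)) *
        uniformSphere d {x | 6 * d * inner ℝ v x ^ 2 < ‖v‖ ^ 2} := by
        rw [lintegral_add_left measurable_const, lintegral_const_mul _
          (measurable_one.indicator hS), lintegral_indicator_one hS]
        simp
    _ ≤ ENNReal.ofReal (Real.exp (-1)) + ENNReal.ofReal (1 - Real.exp (-1)) *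
        ENNReal.ofReal (2 / 3) := by
        gcongr
        exact uniformSphere_inner_sq_lt_le hd v
    _ ≤ _ := by
        rw [← ENNReal.ofReal_mul (by linarith), ← ENNReal.ofReal_add he0.le
          (mul_nonneg (by linarith) (by norm_num))]
        exact ENNReal.ofReal_le_ofReal (by linarith)

/-- Chernoff bound for the number of independent uniform vectors well correlated with `v`. -/
theorem measure_goodCount_lt_le {κ : Type*} [Fintype κ] (hd : 1 ≤ d)
    {b : κ → Ω → EuclideanSpace ℝ (Fin d)} (hb : ∀ r, Measurable (b r))
    (hlaw : ∀ r, μ.map (b r) = uniformSphere d) (hind : iIndepFun b μ)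
    (v : EuclideanSpace ℝ (Fin d)) :
    μ {ω | 6 * goodCount v (fun r => b r ω) ≤ Fintype.card κ} ≤
      ENNReal.ofReal (Real.exp (-(1 / 18) * (Fintype.card κ : ℝ))) := by
  have hg : Measurable fun x : EuclideanSpace ℝ (Fin d) => ENNReal.ofReal (Real.exp
      (-((if ‖v‖ ^ 2 ≤ 6 * d * inner ℝ v x ^ 2 then 1 else 0 : ℕ) : ℝ))) := by
    have : Measurable fun x : EuclideanSpace ℝ (Fin d) =>
        (if ‖v‖ ^ 2 ≤ 6 * d * inner ℝ v x ^ 2 then 1 else 0 : ℕ) :=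
      Measurable.ite (measurableSet_le (by fun_prop) (by fun_prop)) measurable_const
        measurable_const
    fun_prop
  have hgb : ∀ r, Measurable fun ω => ENNReal.ofReal (Real.exp
      (-((if ‖v‖ ^ 2 ≤ 6 * d * inner ℝ v (b r ω) ^ 2 then 1 else 0 : ℕ) : ℝ))) :=
    fun r => hg.comp (hb r)
  have hprod : Measurable fun ω => ∏ r, ENNReal.ofReal (Real.exp
      (-((if ‖v‖ ^ 2 ≤ 6 * d * inner ℝ v (b r ω) ^ 2 then 1 else 0 : ℕ) : ℝ))) :=
    Finset.measurable_prod _ fun r _ => hgb r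
  calc _ ≤ ∫⁻ ω, ENNReal.ofReal (Real.exp ((Fintype.card κ : ℝ) / 6)) *
        ∏ r, ENNReal.ofReal (Real.exp
          (-((if ‖v‖ ^ 2 ≤ 6 * d * inner ℝ v (b r ω) ^ 2 then 1 else 0 : ℕ) : ℝ))) ∂μ := by
        refine meas_le_lintegral₀ (hprod.const_mul _).aemeasurable fun ω hω => ?_
        have hω : 6 * goodCount v (fun r => b r ω) ≤ Fintype.card κ := hω
        have hω' : 6 * (goodCount v (fun r => b r ω) : ℝ) ≤ Fintype.card κ := by exact_mod_cast hω
        rw [← ENNReal.ofReal_prod_of_nonneg fun r _ => (Real.exp_pos _).le,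
          ← ENNReal.ofReal_mul (Real.exp_pos _).le, ← Real.exp_sum, ← Real.exp_add,
          ENNReal.one_le_ofReal, Real.one_le_exp_iff, Finset.sum_neg_distrib, ← Nat.cast_sum]
        change 0 ≤ _ + -(goodCount v (fun r => b r ω) : ℝ)
        linarith
    _ = ENNReal.ofReal (Real.exp ((Fintype.card κ : ℝ) / 6)) * ∏ r, ∫⁻ x, ENNReal.ofReal (Real.exp
          (-((if ‖v‖ ^ 2 ≤ 6 * d * inner ℝ v x ^ 2 then 1 else 0 : ℕ) : ℝ)))
            ∂uniformSphere d := by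
        rw [lintegral_const_mul _ hprod]
        congr 1
        refine (lintegral_prod_eq_prod_lintegral_of_indepFun Finset.univ _
          (hind.comp _ fun _ => hg) hgb).trans ?_
        refine Finset.prod_congr rfl fun r _ => ?_
        rw [← hlaw r, lintegral_map hg (hb r)]
        rfl
    _ ≤ ENNReal.ofReal (Real.exp ((Fintype.card κ : ℝ) / 6)) *
        ∏ _r : κ, ENNReal.ofReal (Real.exp (-(2 / 9))) := by
        gcongr
        exact lintegral_uniformSphere_exp_neg_indicator_le hd v
    _ = _ := by
        rw [Finset.prod_const, Finset.card_univ, ← ENNReal.ofReal_pow (Real.exp_pos _).le,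
          ← ENNReal.ofReal_mul (Real.exp_pos _).le, ← Real.exp_nat_mul, ← Real.exp_add]
        -- The exponent per vector is `1/6 - 2/9 = -1/18`.
        congr 2
        ring

/-- The reference vector is random but depends only on `Φ` and `b j`, both of which can be frozen in
turn without disturbing the law of the remaining vectors. Removing `j` leaves the count `card κ -
1`. -/
theorem measure_goodCount_erase_lt_le [IsProbabilityMeasure μ] {κ α : Type*} [Fintype κ]
    [DecidableEq κ] [MeasurableSpace α] (hd : 1 ≤ d)
    {b : κ → Ω → EuclideanSpace ℝ (Fin d)} (hb : ∀ r, Measurable (b r))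
    (hlaw : ∀ r, μ.map (b r) = uniformSphere d) (hind : iIndepFun b μ)
    {Φ : Ω → α} (hΦ : Measurable Φ) (hΦb : IndepFun Φ (fun ω r => b r ω) μ)
    {V : α × EuclideanSpace ℝ (Fin d) → EuclideanSpace ℝ (Fin d)} (hV : Measurable V) (j : κ) :
    μ {ω | 6 * goodCount (V (Φ ω, b j ω)) (fun r : ↥(Finset.univ.erase j : Finset κ) => b r ω) ≤
      Fintype.card κ - 1} ≤ ENNReal.ofReal (Real.exp (-(1 / 18) * ((Fintype.card κ : ℝ) - 1))) := by
  have hcard : Fintype.card (Finset.univ.erase j : Finset κ) = Fintype.card κ - 1 := by simp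
  have hpos : 1 ≤ Fintype.card κ := Fintype.card_pos_iff.2 ⟨j⟩
  have hcard' : (Fintype.card (Finset.univ.erase j : Finset κ) : ℝ) = Fintype.card κ - 1 := by
    rw [hcard]; push_cast [hpos]; ring
  have hbt : Measurable fun ω r => b r ω := measurable_pi_lambda _ hb
  let B : Set (α × (κ → EuclideanSpace ℝ (Fin d))) := {z | 6 * goodCount (V (z.1, z.2 j))
    (fun r : ↥(Finset.univ.erase j : Finset κ) => z.2 r) ≤ Fintype.card κ - 1}
  have hB : MeasurableSet B := by
    refine measurableSet_le ((measurable_goodCount ?_ ?_).const_mul 6) measurable_const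
    · exact hV.comp (by fun_prop)
    · fun_prop
  refine measure_le_of_indepFun hΦ hbt hΦb hB (Filter.Eventually.of_forall fun φ => ?_)
  have hind2 : IndepFun (b j) (fun ω (r : ↥(Finset.univ.erase j : Finset κ)) => b r ω) μ :=
    (hind.indepFun_finset {j} (Finset.univ.erase j) (by simp) hb).comp
      (measurable_pi_apply (⟨j, Finset.mem_singleton_self j⟩ : ({j} : Finset κ))) measurable_id
  let B' : Set (EuclideanSpace ℝ (Fin d) × (↥(Finset.univ.erase j : Finset κ) →
    EuclideanSpace ℝ (Fin d))) := {z | 6 * goodCount (V (φ, z.1)) z.2 ≤ Fintype.card κ - 1}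
  have hB' : MeasurableSet B' := by
    refine measurableSet_le ((measurable_goodCount ?_ measurable_snd).const_mul 6)
      measurable_const
    exact hV.comp (by fun_prop)
  have hbt' : Measurable fun ω (r : ↥(Finset.univ.erase j : Finset κ)) => b r ω :=
    measurable_pi_lambda _ fun r => hb r
  refine measure_le_of_indepFun (hb j) hbt' hind2 hB'
    (Filter.Eventually.of_forall fun x => ?_)
  have := measure_goodCount_lt_le (μ := μ) hd
    (b := fun (r : ↥(Finset.univ.erase j : Finset κ)) => b r) (fun r => hb r) (fun r => hlaw r)
    (hind.precomp Subtype.val_injective) (V (φ, x))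
  rw [hcard'] at this
  rwa [hcard] at this

end Counting

/-! ### Adjoints, isometries and the combinatorial criterion for TSC. -/

theorem inner_toEuclideanLin_toEuclideanLin {r s t : ℕ} (A : Matrix (Fin r) (Fin s) ℝ)
    (B : Matrix (Fin r) (Fin t) ℝ) (x : EuclideanSpace ℝ (Fin s)) (y : EuclideanSpace ℝ (Fin t)) :
    inner ℝ (Matrix.toEuclideanLin A x) (Matrix.toEuclideanLin B y) =
      inner ℝ (Matrix.toEuclideanLin (Bᵀ * A) x) y := by
  rw [← LinearMap.adjoint_inner_left, ← Matrix.toEuclideanLin_conjTranspose_eq_adjoint,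
    Matrix.conjTranspose_eq_transpose_of_trivial]
  congr 1
  simp [Matrix.toLpLin_apply]

theorem norm_toEuclideanLin_of_orthonormal {r s : ℕ} {A : Matrix (Fin r) (Fin s) ℝ}
    (hA : Aᵀ * A = 1) (x : EuclideanSpace ℝ (Fin s)) : ‖Matrix.toEuclideanLin A x‖ = ‖x‖ := by
  rw [← sq_eq_sq₀ (norm_nonneg _) (norm_nonneg _), ← real_inner_self_eq_norm_sq,
    inner_toEuclideanLin_toEuclideanLin, hA, ← real_inner_self_eq_norm_sq]
  simp

/-- TSC makes no false connections if every point has `q` others that are closer to it than all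
points of the other clusters. -/
theorem noFalseConnections_of_closer {ι κ : Type*} [Fintype ι] [DecidableEq ι] {p q : ℕ}
    {x : ι → EuclideanSpace ℝ (Fin p)} {S : ι → Finset ι} (hS : IsTSCSelection q x S)
    (label : ι → κ)
    (h : ∀ j, ∃ T : Finset ι, q ≤ T.card ∧ ∀ r ∈ T, r ≠ j ∧
      ∀ k, label k ≠ label j → |inner ℝ (x j) (x k)| < |inner ℝ (x j) (x r)|) :
    NoFalseConnections (graphOfAdjacency (tscAdjacency x S)) label := by
  have key : ∀ j, ∀ i ∈ S j, label i = label j := by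
    intro j i hi
    by_contra hne
    obtain ⟨T, hT, hTr⟩ := h j
    obtain ⟨-, hcard, hsel⟩ := hS j
    -- Once a false neighbour `i` is selected, every strictly closer point of `T` must be selected
    -- too, giving `q + 1` elements.
    have hsub : insert i T ⊆ S j := by
      intro r hr
      rcases Finset.mem_insert.1 hr with rfl | hr
      · exact hi
      · by_contra hrS
        exact absurd (hsel i hi r (hTr r hr).1 hrS) (not_le.2 ((hTr r hr).2 i hne))
    have hiT : i ∉ T := fun hiT => lt_irrefl _ ((hTr i hiT).2 i hne)
    have := Finset.card_le_card hsub
    rw [Finset.card_insert_of_notMem hiT] at this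
    omega
  have hZ : ∀ i j, tscZ x S i j ≠ 0 → label i = label j := by
    intro i j hij
    refine key j i ?_
    by_contra hi
    exact hij (by simp [tscZ, hi])
  intro i j hadj
  simp only [graphOfAdjacency, SimpleGraph.fromRel_adj, tscAdjacency, Matrix.add_apply,
    Matrix.transpose_apply] at hadj
  by_contra hne
  have h1 : tscZ x S i j = 0 := by
    by_contra h0
    exact hne (hZ i j h0)
  have h2 : tscZ x S j i = 0 := by
    by_contra h0
    exact hne (hZ j i h0).symm
  simp [h1, h2] at hadj

theorem ae_norm_eq_one_of_map_eq {Ω : Type*} [MeasurableSpace Ω] {μ : Measure Ω} {d : ℕ}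
    {X : Ω → EuclideanSpace ℝ (Fin d)} (hX : Measurable X) (hXlaw : μ.map X = uniformSphere d) :
    ∀ᵐ ω ∂μ, ‖X ω‖ = 1 :=
  ae_of_ae_map hX.aemeasurable (hXlaw ▸ ae_uniformSphere_norm d)

/-! ### Transfer of the fixed-vector bounds to the random data. -/

section Bounds

variable {Ω : Type*} [MeasurableSpace Ω] {μ : Measure Ω} [IsProbabilityMeasure μ] {p m d e : ℕ}
  {X : Ω → EuclideanSpace ℝ (Fin d)} {Y : Ω → EuclideanSpace ℝ (Fin e)}

theorem measure_inner_gt_le (hd : 1 ≤ d) (he : 1 ≤ e) (hX : Measurable X) (hY : Measurable Y)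
    (hXlaw : μ.map X = uniformSphere d) (hYlaw : μ.map Y = uniformSphere e) (h : IndepFun X Y μ)
    (M : Matrix (Fin e) (Fin d) ℝ) {x : ℝ} (hx : 0 ≤ x) :
    μ {ω | x * frobNorm M <
      Real.sqrt d * Real.sqrt e * |inner ℝ (Matrix.toEuclideanLin M (X ω)) (Y ω)|} ≤
      ENNReal.ofReal (4 * Real.exp (-(3 / 4 * x))) := by
  have hMm : Measurable (Matrix.toEuclideanLin M) :=
    (LinearMap.continuous_of_finiteDimensional _).measurable
  have hmeas : MeasurableSet {z : EuclideanSpace ℝ (Fin d) × EuclideanSpace ℝ (Fin e) |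
      x * frobNorm M < Real.sqrt d * Real.sqrt e *
        |inner ℝ (Matrix.toEuclideanLin M z.1) z.2|} := by
    refine measurableSet_lt measurable_const (measurable_const.mul ?_)
    exact (Measurable.inner (hMm.comp measurable_fst) measurable_snd).abs
  have h1 := h.map_prod_eq_prod_map_map hX.aemeasurable hY.aemeasurable
  have h2 := uniformSphere_prod_inner_gt_le hd he M x hx
  rwa [← hXlaw, ← hYlaw, ← h1, Measure.map_apply (hX.prodMk hY) hmeas] at h2

variable {Φ : Ω → Matrix (Fin p) (Fin m) ℝ} {c : ℝ}

/-- Since `Φ` is independent of the pair, `X` and `Y` can be frozen; almost surely they are unit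
vectors, and `A`, `B` are isometries. -/
theorem HasJLProperty.measure_inner_toEuclideanLin_gt_le (h : HasJLProperty μ Φ c)
    (hΦ : Measurable Φ) (hX : Measurable X) (hY : Measurable Y)
    (hXlaw : μ.map X = uniformSphere d) (hYlaw : μ.map Y = uniformSphere e)
    (hind : IndepFun Φ (fun ω => (X ω, Y ω)) μ) {A : Matrix (Fin m) (Fin d) ℝ}
    {B : Matrix (Fin m) (Fin e) ℝ} (hA : Aᵀ * A = 1) (hB : Bᵀ * B = 1) {t : ℝ} (ht : 0 < t)
    (ht1 : t < 1) :
    μ {ω | t < |inner ℝ (Matrix.toEuclideanLin (Φ ω) (Matrix.toEuclideanLin A (X ω)))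
        (Matrix.toEuclideanLin (Φ ω) (Matrix.toEuclideanLin B (Y ω))) -
        inner ℝ (Matrix.toEuclideanLin A (X ω)) (Matrix.toEuclideanLin B (Y ω))|} ≤
      ENNReal.ofReal (4 * Real.exp (-c * t ^ 2 * p)) := by
  have hAm : Measurable (Matrix.toEuclideanLin A) :=
    (LinearMap.continuous_of_finiteDimensional _).measurable
  have hBm : Measurable (Matrix.toEuclideanLin B) :=
    (LinearMap.continuous_of_finiteDimensional _).measurable
  let S : Set ((EuclideanSpace ℝ (Fin d) × EuclideanSpace ℝ (Fin e)) ×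
      Matrix (Fin p) (Fin m) ℝ) :=
    {z | t < |inner ℝ (Matrix.toEuclideanLin z.2 (Matrix.toEuclideanLin A z.1.1))
        (Matrix.toEuclideanLin z.2 (Matrix.toEuclideanLin B z.1.2)) -
        inner ℝ (Matrix.toEuclideanLin A z.1.1) (Matrix.toEuclideanLin B z.1.2)|}
  have hS : MeasurableSet S := by
    have hx : Measurable fun z : (EuclideanSpace ℝ (Fin d) × EuclideanSpace ℝ (Fin e)) ×
      Matrix (Fin p) (Fin m) ℝ => Matrix.toEuclideanLin A z.1.1 := hAm.comp (by fun_prop)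
    have hy : Measurable fun z : (EuclideanSpace ℝ (Fin d) × EuclideanSpace ℝ (Fin e)) ×
      Matrix (Fin p) (Fin m) ℝ => Matrix.toEuclideanLin B z.1.2 := hBm.comp (by fun_prop)
    refine measurableSet_lt measurable_const (Measurable.abs (Measurable.sub ?_ ?_))
    · exact Measurable.inner (measurable_toEuclideanLin measurable_snd hx)
        (measurable_toEuclideanLin measurable_snd hy)
    · exact Measurable.inner hx hy
  refine measure_le_of_indepFun (hX.prodMk hY) hΦ hind.symm hS ?_
  have hae : ∀ᵐ z ∂μ.map (fun ω => (X ω, Y ω)), ‖z.1‖ = 1 ∧ ‖z.2‖ = 1 := by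
    have hms : MeasurableSet {z : EuclideanSpace ℝ (Fin d) × EuclideanSpace ℝ (Fin e) |
        ‖z.1‖ = 1 ∧ ‖z.2‖ = 1} :=
      (measurableSet_eq_fun measurable_fst.norm measurable_const).inter
        (measurableSet_eq_fun measurable_snd.norm measurable_const)
    rw [ae_map_iff (hX.prodMk hY).aemeasurable hms]
    filter_upwards [ae_norm_eq_one_of_map_eq hX hXlaw, ae_norm_eq_one_of_map_eq hY hYlaw]
      with ω h1 h2
    exact ⟨h1, h2⟩
  filter_upwards [hae] with z hz
  exact h.measure_inner_gt_le ((norm_toEuclideanLin_of_orthonormal hA _).trans hz.1)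
    ((norm_toEuclideanLin_of_orthonormal hB _).trans hz.2) ht ht1

theorem HasJLProperty.measure_norm_sq_toEuclideanLin_lt_le (h : HasJLProperty μ Φ c)
    (hΦ : Measurable Φ) (hX : Measurable X) (hXlaw : μ.map X = uniformSphere d)
    (hind : IndepFun Φ X μ) {A : Matrix (Fin m) (Fin d) ℝ} (hA : Aᵀ * A = 1) {t : ℝ}
    (ht : 0 < t) (ht1 : t < 1) :
    μ {ω | ‖Matrix.toEuclideanLin (Φ ω) (Matrix.toEuclideanLin A (X ω))‖ ^ 2 < 1 - t} ≤
      ENNReal.ofReal (2 * Real.exp (-c * t ^ 2 * p)) := by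
  have hAm : Measurable (Matrix.toEuclideanLin A) :=
    (LinearMap.continuous_of_finiteDimensional _).measurable
  let S : Set (EuclideanSpace ℝ (Fin d) × Matrix (Fin p) (Fin m) ℝ) :=
    {z | ‖Matrix.toEuclideanLin z.2 (Matrix.toEuclideanLin A z.1)‖ ^ 2 < 1 - t}
  have hS : MeasurableSet S :=
    measurableSet_lt ((measurable_toEuclideanLin measurable_snd
      (hAm.comp measurable_fst)).norm.pow_const 2) measurable_const
  refine measure_le_of_indepFun hX hΦ hind.symm hS ?_
  rw [hXlaw]
  filter_upwards [ae_uniformSphere_norm d] with x hx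
  exact h.measure_norm_sq_lt_le ((norm_toEuclideanLin_of_orthonormal hA _).trans hx) ht ht1

end Bounds

/-! ### The deterministic comparison on the good event. -/

section Deterministic

variable {L m p : ℕ} {d n : Fin L → ℕ} {U : ∀ l, Matrix (Fin m) (Fin (d l)) ℝ}
  {φ : Matrix (Fin p) (Fin m) ℝ}
  {a : ∀ i : (Σ l : Fin L, Fin (n l)), EuclideanSpace ℝ (Fin (d i.1))}

/-- The vector `Tᵀ T x` for `T = φ A`, whose inner products with `y` are `⟪T x, T y⟫`. -/
noncomputable def gramVector {p m d : ℕ} (A : Matrix (Fin m) (Fin d) ℝ)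
    (z : Matrix (Fin p) (Fin m) ℝ × EuclideanSpace ℝ (Fin d)) : EuclideanSpace ℝ (Fin d) :=
  Matrix.toEuclideanLin ((z.1 * A)ᵀ * (z.1 * A)) z.2

theorem inner_gramVector {p m d : ℕ} (A : Matrix (Fin m) (Fin d) ℝ)
    (φ : Matrix (Fin p) (Fin m) ℝ) (x y : EuclideanSpace ℝ (Fin d)) :
    inner ℝ (gramVector A (φ, x)) y =
      inner ℝ (Matrix.toEuclideanLin φ (Matrix.toEuclideanLin A x))
        (Matrix.toEuclideanLin φ (Matrix.toEuclideanLin A y)) := by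
  rw [gramVector, ← inner_toEuclideanLin_toEuclideanLin]
  simp [Matrix.toLpLin_apply]

theorem measurable_gramVector {p m d : ℕ} (A : Matrix (Fin m) (Fin d) ℝ) :
    Measurable (gramVector (p := p) A) := by
  refine measurable_toEuclideanLin (measurable_matrix_of_entry fun i j => ?_) measurable_snd
  simp only [Matrix.mul_apply, Matrix.transpose_apply]
  have h : ∀ k l, Measurable fun z : Matrix (Fin p) (Fin m) ℝ × EuclideanSpace ℝ (Fin d) =>
      z.1 k l := measurable_matrix_entry measurable_fst
  exact Finset.measurable_sum _ fun k _ => (Finset.measurable_sum _ fun l _ =>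
    (h k l).mul_const _).mul (Finset.measurable_sum _ fun l _ => (h k l).mul_const _)

/-- Replacing `min d e` by `d` lets the factor `√d` cancel against the one in the tail bound for the
bilinear form. -/
theorem sqrt_mul_frobNorm_le_affinity {m d e : ℕ} (hd : 1 ≤ d) (he : 1 ≤ e)
    (A : Matrix (Fin m) (Fin d) ℝ) (B : Matrix (Fin m) (Fin e) ℝ) :
    frobNorm (Aᵀ * B) ≤ Real.sqrt d * affinity A B := by
  have hmin : (0 : ℝ) < (min d e : ℕ) := by exact_mod_cast lt_min hd he
  have h1 : 0 < Real.sqrt ((min d e : ℕ) : ℝ) := Real.sqrt_pos.2 hmin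
  have h2 : Real.sqrt ((min d e : ℕ) : ℝ) ≤ Real.sqrt d :=
    Real.sqrt_le_sqrt (by exact_mod_cast min_le_left d e)
  calc frobNorm (Aᵀ * B) = Real.sqrt ((min d e : ℕ) : ℝ) * affinity A B := by
        rw [affinity]; field_simp
    _ ≤ _ := by
        gcongr
        exact mul_nonneg (by positivity) (frobNorm_nonneg _)

theorem affinity_nonneg {m d e : ℕ} (A : Matrix (Fin m) (Fin d) ℝ)
    (B : Matrix (Fin m) (Fin e) ℝ) : 0 ≤ affinity A B :=
  mul_nonneg (by positivity) (frobNorm_nonneg _)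

/-- After scaling by `√d_l`, a false correlation is at most `4Λ (aff + β) ≤ 4/15`, while a good true
one is at least `‖v‖/√6 ≥ (3/4)/√6`, which is larger. -/
theorem exists_closer_points {q : ℕ} (hd : ∀ l, 1 ≤ d l) (hn : ∀ l, 6 * q ≤ n l) {β Λ : ℝ}
    (hΛ : 0 < Λ) (haff : ∀ k l, k ≠ l → affinity (U k) (U l) + β ≤ 1 / (15 * Λ))
    (hnorm : ∀ i, ‖a i‖ = 1)
    (hinner : ∀ i j : (Σ l : Fin L, Fin (n l)), i.1 ≠ j.1 →
      Real.sqrt (d j.1) * Real.sqrt (d i.1) *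
        |inner ℝ (Matrix.toEuclideanLin ((U i.1)ᵀ * U j.1) (a j)) (a i)| ≤
        4 * Λ * frobNorm ((U i.1)ᵀ * U j.1))
    (hJL : ∀ i j : (Σ l : Fin L, Fin (n l)), i.1 ≠ j.1 →
      |inner ℝ (projectedData U φ a j) (projectedData U φ a i) -
        inner ℝ (Matrix.toEuclideanLin (U j.1) (a j)) (Matrix.toEuclideanLin (U i.1) (a i))| ≤
        4 * Λ * β / Real.sqrt (d j.1))
    (hlow : ∀ j, 3 / 4 ≤ ‖projectedData U φ a j‖ ^ 2)
    (hcount : ∀ j : (Σ l : Fin L, Fin (n l)), n j.1 - 1 <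
      6 * goodCount (gramVector (U j.1) (φ, a j))
        (fun r : ↥(Finset.univ.erase j.2 : Finset (Fin (n j.1))) => a ⟨j.1, r⟩))
    (j : Σ l : Fin L, Fin (n l)) :
    ∃ T : Finset (Σ l : Fin L, Fin (n l)), q ≤ T.card ∧ ∀ r ∈ T, r ≠ j ∧
      ∀ k, k.1 ≠ j.1 → |inner ℝ (projectedData U φ a j) (projectedData U φ a k)| <
        |inner ℝ (projectedData U φ a j) (projectedData U φ a r)| := by
  obtain ⟨l, j⟩ := j
  have hdl : (1 : ℝ) ≤ d l := by exact_mod_cast hd l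
  set v := gramVector (U l) (φ, a ⟨l, j⟩) with hv
  have hinn : ∀ r : Fin (n l), inner ℝ v (a ⟨l, r⟩) =
      inner ℝ (projectedData U φ a ⟨l, j⟩) (projectedData U φ a ⟨l, r⟩) := fun r =>
    inner_gramVector _ _ _ _
  -- Testing `v` against the unit vector `a_j` itself gives `‖v‖ ≥ ‖x_j‖²`.
  have hvn : 3 / 4 ≤ ‖v‖ := by
    have h1 := real_inner_le_norm v (a ⟨l, j⟩)
    rw [hinn, real_inner_self_eq_norm_sq, hnorm, mul_one] at h1
    exact (hlow ⟨l, j⟩).trans h1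
  let e : ↥(Finset.univ.erase j : Finset (Fin (n l))) ↪ (Σ l : Fin L, Fin (n l)) :=
    ⟨fun r => ⟨l, r⟩, fun r s hrs => Subtype.ext (eq_of_heq (Sigma.mk.inj_iff.1 hrs).2)⟩
  let G : Finset ↥(Finset.univ.erase j : Finset (Fin (n l))) :=
    Finset.univ.filter fun r => ‖v‖ ^ 2 ≤ 6 * d l * inner ℝ v (a ⟨l, r⟩) ^ 2
  refine ⟨G.map e, ?_, ?_⟩
  · have hG : G.card = goodCount v
        (fun r : ↥(Finset.univ.erase j : Finset (Fin (n l))) => a ⟨l, r⟩) :=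
      Finset.card_filter _ _
    have h1 : n l - 1 < 6 * goodCount v
        (fun r : ↥(Finset.univ.erase j : Finset (Fin (n l))) => a ⟨l, r⟩) := hcount ⟨l, j⟩
    have h2 := hn l
    rw [Finset.card_map, hG]
    -- Here `n_l - 1 < 6 · count` means `6 · count ≥ n_l ≥ 6q`; the strict inequality absorbs the
    -- loss of the point `j`.
    omega
  · intro r hr
    obtain ⟨s, hs, rfl⟩ := Finset.mem_map.1 hr
    have hsj : s.1 ≠ j := (Finset.mem_erase.1 s.2).1
    refine ⟨fun h => hsj (eq_of_heq (Sigma.mk.inj_iff.1 h).2), fun k hk => ?_⟩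
    have hk : k.1 ≠ l := hk
    change _ < |inner ℝ (projectedData U φ a ⟨l, j⟩) (projectedData U φ a ⟨l, s⟩)|
    rw [← hinn]
    have hs' : ‖v‖ ^ 2 ≤ 6 * d l * inner ℝ v (a ⟨l, s⟩) ^ 2 := (Finset.mem_filter.1 hs).2
    have hdk : 0 < Real.sqrt (d k.1) := Real.sqrt_pos.2 (by exact_mod_cast hd k.1)
    have hdj : 0 < Real.sqrt (d l) := Real.sqrt_pos.2 (by linarith)
    have hI := hinner k ⟨l, j⟩ hk
    have hJ := hJL k ⟨l, j⟩ hk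
    have hA := haff k.1 l hk
    rw [inner_toEuclideanLin_toEuclideanLin] at hJ
    set I := inner ℝ (Matrix.toEuclideanLin ((U k.1)ᵀ * U l) (a ⟨l, j⟩)) (a k)
    set P := inner ℝ (projectedData U φ a ⟨l, j⟩) (projectedData U φ a k)
    have hF := sqrt_mul_frobNorm_le_affinity (hd k.1) (hd l) (U k.1) (U l)
    have hI2 : Real.sqrt (d l) * |I| ≤ 4 * Λ * affinity (U k.1) (U l) := by
      refine le_of_mul_le_mul_left ?_ hdk
      calc Real.sqrt (d k.1) * (Real.sqrt (d l) * |I|) =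
          Real.sqrt (d l) * Real.sqrt (d k.1) * |I| := by ring
        _ ≤ 4 * Λ * frobNorm ((U k.1)ᵀ * U l) := hI
        _ ≤ 4 * Λ * (Real.sqrt (d k.1) * affinity (U k.1) (U l)) := by gcongr
        _ = _ := by ring
    have hJ2 : Real.sqrt (d l) * |P - I| ≤ 4 * Λ * β := by
      rwa [le_div_iff₀' hdj] at hJ
    have hP : Real.sqrt (d l) * |P| ≤ 4 / 15 := by
      have h1 : |P| ≤ |P - I| + |I| := by simpa using abs_add_le (P - I) I
      have h2 : 4 * Λ * (affinity (U k.1) (U l) + β) ≤ 4 * Λ * (1 / (15 * Λ)) := by gcongr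
      have h3 : 4 * Λ * (1 / (15 * Λ)) = 4 / 15 := by field_simp
      nlinarith [mul_le_mul_of_nonneg_left h1 hdj.le]
    refine lt_of_mul_lt_mul_left (lt_of_le_of_lt hP ?_) hdj.le
    refine lt_of_pow_lt_pow_left₀ 2 (by positivity) ?_
    rw [mul_pow, sq_abs, Real.sq_sqrt (by positivity)]
    -- The comparison is `(4/15)² = 16/225 < 3/32 = (9/16)/6`.
    nlinarith

end Deterministic

/-! ### Choice of the parameters and the union bound. -/

theorem two_le_log_of_eight_le {N : ℕ} (hN : 8 ≤ N) : 2 ≤ Real.log N := by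
  have h8 : (8 : ℝ) ≤ N := by exact_mod_cast hN
  rw [Real.le_log_iff_exp_le (by linarith)]
  have h2 : Real.exp 2 = Real.exp 1 ^ 2 := by rw [← Real.exp_nat_mul]; norm_num
  rw [h2]
  have := Real.exp_one_lt_d9
  nlinarith [Real.exp_pos 1]

theorem exp_neg_le_inv_pow {N : ℕ} (hN : 0 < N) {k : ℕ} {y : ℝ} (hy : k * Real.log N ≤ y) :
    Real.exp (-y) ≤ ((N : ℝ) ^ k)⁻¹ := by
  have hN' : (0 : ℝ) < N := by exact_mod_cast hN
  rw [Real.exp_neg]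
  refine inv_anti₀ (by positivity) ?_
  rw [← Real.exp_log (by positivity : (0 : ℝ) < (N : ℝ) ^ k), Real.log_pow]
  exact Real.exp_le_exp.2 hy

/-- Lower bound on the success probability of TSC when there are at least two clusters and enough
points. -/
theorem one_sub_le_measure_noFalseConnections {L m p q : ℕ} {d n : Fin L → ℕ}
    {U : ∀ l, Matrix (Fin m) (Fin (d l)) ℝ} {Ω : Type*} [MeasurableSpace Ω] {μ : Measure Ω}
    [IsProbabilityMeasure μ] {Φ : Ω → Matrix (Fin p) (Fin m) ℝ}
    {a : ∀ i : (Σ l : Fin L, Fin (n l)), Ω → EuclideanSpace ℝ (Fin (d i.1))} {c : ℝ}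
    (hp : 0 < p) (hd : ∀ l, 1 ≤ d l) (hU : ∀ l, (U l)ᵀ * U l = 1) (hΦ : Measurable Φ)
    (ha : ∀ i, Measurable (a i)) (hlaw : ∀ i, μ.map (a i) = uniformSphere (d i.1))
    (hind : iIndepFun a μ) (hΦa : IndepFun Φ (fun ω i => a i ω) μ) (hc : 0 < c)
    (hJL : HasJLProperty μ Φ c) (hn : ∀ l, 6 * q ≤ n l)
    (haff : ∀ k l, k ≠ l → affinity (U k) (U l) + Real.sqrt 10 / Real.sqrt (12 * c)
      * (Real.sqrt ((Finset.univ.sup d : ℕ) : ℝ) / Real.sqrt (p : ℝ))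
        ≤ 1 / (15 * Real.log ((∑ l, n l : ℕ) : ℝ)))
    (hL : ∃ k l : Fin L, k ≠ l) (hN : 8 ≤ ∑ l, n l) :
    1 - 7 * ((∑ l, n l : ℕ) : ℝ)⁻¹
        - ∑ l, (n l : ℝ) * Real.exp (-(1 / 18) * ((n l : ℝ) - 1))
      ≤ μ.real {ω | ∀ S : (Σ l : Fin L, Fin (n l)) → Finset (Σ l : Fin L, Fin (n l)),
          IsTSCSelection q (projectedData U (Φ ω) fun i => a i ω) S →
            NoFalseConnections (graphOfAdjacency
              (tscAdjacency (projectedData U (Φ ω) fun i => a i ω) S)) (fun i => i.1)} := by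
  set N := ∑ l, n l with hNdef
  set D := Finset.univ.sup d
  set β := Real.sqrt 10 / Real.sqrt (12 * c) * (Real.sqrt (D : ℝ) / Real.sqrt (p : ℝ)) with hβ
  set Λ := Real.log (N : ℝ)
  have hΛ : 2 ≤ Λ := two_le_log_of_eight_le hN
  have hp' : (0 : ℝ) < p := by exact_mod_cast hp
  have hN' : (8 : ℝ) ≤ N := by exact_mod_cast hN
  have hdD : ∀ l, (d l : ℝ) ≤ D := fun l => by
    exact_mod_cast Finset.le_sup (f := d) (Finset.mem_univ l)
  obtain ⟨k₀, l₀, hkl₀⟩ := hL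
  have hD1 : (1 : ℝ) ≤ D := le_trans (by exact_mod_cast hd k₀) (hdD k₀)
  have hβ0 : 0 < β := by positivity
  have hβsq : c * p * β ^ 2 = 10 / 12 * D := by
    rw [hβ, mul_pow, div_pow, div_pow, Real.sq_sqrt (by norm_num), Real.sq_sqrt (by positivity),
      Real.sq_sqrt (by positivity), Real.sq_sqrt (by positivity)]
    field_simp
  -- The affinity is nonnegative and a pair of distinct clusters exists, so the hypothesis bounds
  -- `β` alone.
  have hβΛ : β * (15 * Λ) ≤ 1 := by
    have h1 := haff k₀ l₀ hkl₀
    have h2 := affinity_nonneg (U k₀) (U l₀)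
    rw [← le_div_iff₀ (by positivity)]
    linarith
  let t : Fin L → ℝ := fun l => 4 * Λ * β / Real.sqrt (d l)
  have hsd : ∀ l, 1 ≤ Real.sqrt (d l) := fun l => Real.one_le_sqrt.2 (by exact_mod_cast hd l)
  have ht0 : ∀ l, 0 < t l := fun l => div_pos (by positivity) (by linarith [hsd l])
  have ht1 : ∀ l, t l < 1 := fun l => by
    rw [div_lt_one (by linarith [hsd l])]
    linarith [hsd l]
  -- The exponent is `(40/3) Λ² D/d_l`, ample because `Λ ≥ 2`. The extra 2 absorbs the prefactor 4
  -- of the polarized bound, as `4 ≤ e²`.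
  have htexp : ∀ l, (3 : ℕ) * Λ + 2 ≤ c * t l ^ 2 * p := by
    intro l
    have hdl : (1 : ℝ) ≤ d l := by exact_mod_cast hd l
    have h1 : c * t l ^ 2 * p = 16 * Λ ^ 2 * (10 / 12 * (D / d l)) := by
      simp only [t]
      rw [div_pow, Real.sq_sqrt (by positivity)]
      calc _ = 16 * Λ ^ 2 * (c * p * β ^ 2) / d l := by ring
        _ = _ := by rw [hβsq]; ring
    have h2 : 1 ≤ (D : ℝ) / d l := by
      rw [one_le_div (by linarith)]
      exact hdD l
    have h3 : 16 * Λ ^ 2 * (10 / 12 * 1) ≤ 16 * Λ ^ 2 * (10 / 12 * (D / d l)) := by gcongr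
    rw [h1]
    push_cast
    nlinarith
  have hcp : (3 : ℕ) * Λ ≤ c * (1 / 4) ^ 2 * p := by
    have h1 : (β * (15 * Λ)) ^ 2 ≤ 1 := pow_le_one₀ (by positivity) hβΛ
    have h2 : 225 * Λ ^ 2 * (10 / 12 * D) ≤ c * p := by
      rw [← hβsq]
      calc _ = c * p * (β * (15 * Λ)) ^ 2 := by ring
        _ ≤ c * p * 1 := by gcongr
        _ = _ := mul_one _
    have h3 : 225 * Λ ^ 2 * (10 / 12 * 1) ≤ 225 * Λ ^ 2 * (10 / 12 * D) := by gcongr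
    push_cast
    nlinarith
  have hpair : ∀ i j, i ≠ j → IndepFun (a j) (a i) μ := fun i j hij => hind.indepFun hij.symm
  have hat : Measurable fun ω i => a i ω := measurable_pi_lambda _ ha
  let F₁ (j i : Σ l : Fin L, Fin (n l)) : Set Ω := {ω | i.1 ≠ j.1 ∧
    4 * Λ * frobNorm ((U i.1)ᵀ * U j.1) < Real.sqrt (d j.1) * Real.sqrt (d i.1) *
      |inner ℝ (Matrix.toEuclideanLin ((U i.1)ᵀ * U j.1) (a j ω)) (a i ω)|}
  let F₂ (j i : Σ l : Fin L, Fin (n l)) : Set Ω := {ω | i.1 ≠ j.1 ∧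
    t j.1 < |inner ℝ (projectedData U (Φ ω) (fun i => a i ω) j)
        (projectedData U (Φ ω) (fun i => a i ω) i) -
      inner ℝ (Matrix.toEuclideanLin (U j.1) (a j ω)) (Matrix.toEuclideanLin (U i.1) (a i ω))|}
  let G₁ (j : Σ l : Fin L, Fin (n l)) : Set Ω :=
    {ω | ‖projectedData U (Φ ω) (fun i => a i ω) j‖ ^ 2 < 1 - 1 / 4}
  let G₂ (j : Σ l : Fin L, Fin (n l)) : Set Ω :=
    {ω | 6 * goodCount (gramVector (U j.1) (Φ ω, a j ω))
      (fun r : ↥(Finset.univ.erase j.2 : Finset (Fin (n j.1))) => a ⟨j.1, r⟩ ω) ≤ n j.1 - 1}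
  let Z : Set Ω := {ω | ¬ ∀ i, ‖a i ω‖ = 1}
  -- The threshold `4Λ` turns `exp(-3x/4)` into `N⁻³`. Pairs within one cluster contribute empty
  -- events.
  have hF₁ : ∀ j i, μ (F₁ j i) ≤ ENNReal.ofReal (4 * ((N : ℝ) ^ 3)⁻¹) := by
    intro j i
    by_cases hij : i.1 = j.1
    · simp [F₁, hij]
    refine (measure_mono fun ω hω => hω.2).trans ((measure_inner_gt_le (hd j.1) (hd i.1) (ha j)
      (ha i) (hlaw j) (hlaw i) (hpair i j fun h => hij (h ▸ rfl)) _ (x := 4 * Λ)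
      (by positivity)).trans (ENNReal.ofReal_le_ofReal ?_))
    gcongr
    exact exp_neg_le_inv_pow (by omega) (by push_cast; linarith)
  have hF₂ : ∀ j i, μ (F₂ j i) ≤ ENNReal.ofReal (((N : ℝ) ^ 3)⁻¹) := by
    intro j i
    by_cases hij : i.1 = j.1
    · simp [F₂, hij]
    have hI : IndepFun Φ (fun ω => (a j ω, a i ω)) μ :=
      hΦa.comp (φ := id) (ψ := fun f : (∀ i : (Σ l : Fin L, Fin (n l)),
        EuclideanSpace ℝ (Fin (d i.1))) => (f j, f i)) measurable_id (by fun_prop)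
    refine (measure_mono fun ω hω => hω.2).trans ((hJL.measure_inner_toEuclideanLin_gt_le hΦ
      (ha j) (ha i) (hlaw j) (hlaw i) hI (hU j.1) (hU i.1) (ht0 j.1) (ht1 j.1)).trans
      (ENNReal.ofReal_le_ofReal ?_))
    have h4 : (4 : ℝ) ≤ Real.exp 2 := by
      have h2 : Real.exp 2 = Real.exp 1 ^ 2 := by rw [← Real.exp_nat_mul]; norm_num
      rw [h2]
      nlinarith [Real.exp_one_gt_d9]
    calc 4 * Real.exp (-c * t j.1 ^ 2 * p) ≤
        Real.exp 2 * Real.exp (-c * t j.1 ^ 2 * p) := by gcongr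
      _ = Real.exp (-(c * t j.1 ^ 2 * p - 2)) := by rw [← Real.exp_add]; congr 1; ring
      _ ≤ _ := exp_neg_le_inv_pow (by omega) (by linarith [htexp j.1])
  have hG₁ : ∀ j, μ (G₁ j) ≤ ENNReal.ofReal (2 * ((N : ℝ) ^ 3)⁻¹) := by
    intro j
    have hI : IndepFun Φ (a j) μ :=
      hΦa.comp (φ := id) (ψ := fun f : (∀ i : (Σ l : Fin L, Fin (n l)),
        EuclideanSpace ℝ (Fin (d i.1))) => f j) measurable_id (by fun_prop)
    refine (hJL.measure_norm_sq_toEuclideanLin_lt_le hΦ (ha j) (hlaw j) hI (hU j.1)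
      (by norm_num) (by norm_num)).trans (ENNReal.ofReal_le_ofReal ?_)
    gcongr
    rw [neg_mul, neg_mul]
    exact exp_neg_le_inv_pow (by omega) hcp
  have hG₂ : ∀ j, μ (G₂ j) ≤ ENNReal.ofReal (Real.exp (-(1 / 18) * ((n j.1 : ℝ) - 1))) := by
    intro j
    have hI : IndepFun Φ (fun ω (r : Fin (n j.1)) => a ⟨j.1, r⟩ ω) μ :=
      hΦa.comp (φ := id) (ψ := fun (f : (∀ i : (Σ l : Fin L, Fin (n l)),
        EuclideanSpace ℝ (Fin (d i.1)))) (r : Fin (n j.1)) => f ⟨j.1, r⟩) measurable_id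
        (by fun_prop)
    have hI2 : iIndepFun (fun r : Fin (n j.1) => a ⟨j.1, r⟩) μ :=
      hind.precomp (g := fun r : Fin (n j.1) => (⟨j.1, r⟩ : Σ l : Fin L, Fin (n l)))
        fun r s hrs => eq_of_heq (Sigma.mk.inj_iff.1 hrs).2
    have h := measure_goodCount_erase_lt_le (hd j.1) (fun r => ha ⟨j.1, r⟩)
      (fun r => hlaw ⟨j.1, r⟩) hI2 hΦ hI (measurable_gramVector (U j.1)) j.2
    rwa [Fintype.card_fin] at h
  have hZ : μ Z = 0 :=
    ae_iff.1 (ae_all_iff.2 fun i => ae_norm_eq_one_of_map_eq (ha i) (hlaw i))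
  set E := {ω | ∀ S : (Σ l : Fin L, Fin (n l)) → Finset (Σ l : Fin L, Fin (n l)),
    IsTSCSelection q (projectedData U (Φ ω) fun i => a i ω) S →
      NoFalseConnections (graphOfAdjacency
        (tscAdjacency (projectedData U (Φ ω) fun i => a i ω) S)) (fun i => i.1)}
  have hsub : Eᶜ ⊆ Z ∪ ⋃ j, (G₁ j ∪ G₂ j ∪ ⋃ i, (F₁ j i ∪ F₂ j i)) := by
    intro ω hω
    by_contra hbad
    simp only [Set.mem_union, Set.mem_iUnion, not_or, not_exists] at hbad
    obtain ⟨hZω, hb⟩ := hbad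
    refine hω fun S hS => noFalseConnections_of_closer hS (fun i => i.1) ?_
    refine exists_closer_points hd hn (by linarith : (0 : ℝ) < Λ) haff (not_not.1 hZω) ?_ ?_ ?_ ?_
    · exact fun i j hij => not_lt.1 fun h => ((hb j).2 i).1 ⟨hij, h⟩
    · exact fun i j hij => not_lt.1 fun h => ((hb j).2 i).2 ⟨hij, h⟩
    · intro j
      have := not_lt.1 (show ¬ ‖projectedData U (Φ ω) (fun i => a i ω) j‖ ^ 2 < 1 - 1 / 4 from (hb j).1.1)
      linarith
    · exact fun j => not_le.1 (hb j).1.2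
  have hbound : μ Eᶜ ≤ ENNReal.ofReal (7 * (N : ℝ)⁻¹ +
      ∑ l, (n l : ℝ) * Real.exp (-(1 / 18) * ((n l : ℝ) - 1))) := by
    have hcard : (Fintype.card (Σ l : Fin L, Fin (n l)) : ℝ) = N := by
      simp [hNdef]
    have hsumF : ∀ j, μ (⋃ i, (F₁ j i ∪ F₂ j i)) ≤ ENNReal.ofReal (5 * ((N : ℝ) ^ 2)⁻¹) := by
      intro j
      calc μ (⋃ i, (F₁ j i ∪ F₂ j i)) ≤ ∑ i, μ (F₁ j i ∪ F₂ j i) := measure_iUnion_fintype_le _ _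
        _ ≤ ∑ _i : (Σ l : Fin L, Fin (n l)), ENNReal.ofReal (5 * ((N : ℝ) ^ 3)⁻¹) := by
            refine Finset.sum_le_sum fun i _ => (measure_union_le _ _).trans
              ((add_le_add (hF₁ j i) (hF₂ j i)).trans ?_)
            rw [← ENNReal.ofReal_add (by positivity) (by positivity)]
            exact ENNReal.ofReal_le_ofReal (by linarith)
        _ = _ := by
            rw [← ENNReal.ofReal_sum_of_nonneg fun i _ => by positivity, Finset.sum_const,
              Finset.card_univ, nsmul_eq_mul, hcard]
            congr 1
            field_simp
    calc μ Eᶜ ≤ μ Z + ∑ j, μ (G₁ j ∪ G₂ j ∪ ⋃ i, (F₁ j i ∪ F₂ j i)) :=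
          (measure_mono hsub).trans ((measure_union_le _ _).trans
            (by gcongr; exact measure_iUnion_fintype_le _ _))
      _ ≤ ∑ j : (Σ l : Fin L, Fin (n l)), ENNReal.ofReal (7 * ((N : ℝ) ^ 2)⁻¹ +
          Real.exp (-(1 / 18) * ((n j.1 : ℝ) - 1))) := by
          rw [hZ, zero_add]
          refine Finset.sum_le_sum fun j _ => (measure_union_le _ _).trans ((add_le_add
            ((measure_union_le _ _).trans (add_le_add (hG₁ j) (hG₂ j))) (hsumF j)).trans ?_)
          rw [← ENNReal.ofReal_add (by positivity) (by positivity),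
            ← ENNReal.ofReal_add (by positivity) (by positivity)]
          refine ENNReal.ofReal_le_ofReal ?_
          -- The `N²` pairs contribute `(4 + 1)/N`. The norm events, a sum over only `N` points, are
          -- weakened to `2/N`, for a total of `7/N`.
          have : ((N : ℝ) ^ 3)⁻¹ ≤ ((N : ℝ) ^ 2)⁻¹ :=
            inv_anti₀ (by positivity) (pow_le_pow_right₀ (by linarith) (by norm_num))
          linarith
      _ = _ := by
          rw [← ENNReal.ofReal_sum_of_nonneg fun i _ => by positivity, Finset.sum_add_distrib,
            Finset.sum_const, Finset.card_univ, nsmul_eq_mul, hcard, Fintype.sum_sigma]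
          congr 2
          · field_simp
          · simp
  have hreal : μ.real Eᶜ ≤ 7 * (N : ℝ)⁻¹ +
      ∑ l, (n l : ℝ) * Real.exp (-(1 / 18) * ((n l : ℝ) - 1)) :=
    ENNReal.toReal_le_of_le_ofReal (by positivity) hbound
  -- Subadditivity suffices here, so measurability of `E` is not needed.
  have htot : (1 : ℝ) ≤ μ.real E + μ.real Eᶜ := by
    have := measureReal_union_le (μ := μ) E Eᶜ
    rwa [Set.union_compl_self, probReal_univ] at this
  linarith

end SubspaceClustering

theorem theorem2 :
    ∃ c : ℝ, 1 / 20 < c ∧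
      ∀ (L m p q : ℕ) (d n : Fin L → ℕ) (U : ∀ l, Matrix (Fin m) (Fin (d l)) ℝ)
        (Ω : Type*) [MeasurableSpace Ω] (μ : Measure Ω) [IsProbabilityMeasure μ]
        (Φ : Ω → Matrix (Fin p) (Fin m) ℝ)
        (a : ∀ i : (Σ l : Fin L, Fin (n l)), Ω → EuclideanSpace ℝ (Fin (d i.1)))
        (cJL : ℝ),
        0 < p →
        (∀ l, 1 ≤ d l) →
        (∀ l, (U l)ᵀ * U l = 1) →
        Measurable Φ →
        (∀ i, Measurable (a i)) →
        (∀ i, μ.map (a i) = uniformSphere (d i.1)) →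
        iIndepFun a μ →
        IndepFun Φ (fun ω i => a i ω) μ →
        0 < cJL →
        HasJLProperty μ Φ cJL →
        (∀ l, 6 * q ≤ n l) →
        (∀ k l, k ≠ l →
          affinity (U k) (U l)
            + Real.sqrt 10 / Real.sqrt (12 * cJL)
              * (Real.sqrt ((Finset.univ.sup d : ℕ) : ℝ) / Real.sqrt (p : ℝ))
            ≤ 1 / (15 * Real.log ((∑ l, n l : ℕ) : ℝ))) →
        1 - 7 * ((∑ l, n l : ℕ) : ℝ)⁻¹
            - ∑ l, (n l : ℝ) * Real.exp (-c * ((n l : ℝ) - 1))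
          ≤ μ.real {ω | ∀ S : (Σ l : Fin L, Fin (n l)) → Finset (Σ l : Fin L, Fin (n l)),
              IsTSCSelection q (projectedData U (Φ ω) fun i => a i ω) S →
                NoFalseConnections
                  (graphOfAdjacency
                    (tscAdjacency (projectedData U (Φ ω) fun i => a i ω) S))
                  (fun i => i.1)} := by
  -- The Chernoff rate. Fewer than two clusters make the event certain, as does `N = 0`; for `1 ≤ N
  -- ≤ 7` the term `7/N` makes the bound trivial.
  refine ⟨1 / 18, by norm_num, ?_⟩
  intro L m p q d n U Ω _ μ _ Φ a cJL hp hd hU hΦ ha hlaw hind hΦa hc hJL hn haff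
  have h0 : 0 ≤ ∑ l, (n l : ℝ) * Real.exp (-(1 / 18) * ((n l : ℝ) - 1)) := by positivity
  have hsingle (h : ∀ i j : (Σ l : Fin L, Fin (n l)), i.1 = j.1) :
      μ.real {ω | ∀ S : (Σ l : Fin L, Fin (n l)) → Finset (Σ l : Fin L, Fin (n l)),
        IsTSCSelection q (projectedData U (Φ ω) fun i => a i ω) S →
          NoFalseConnections (graphOfAdjacency
            (tscAdjacency (projectedData U (Φ ω) fun i => a i ω) S)) (fun i => i.1)} = 1 := by
    rw [← probReal_univ (μ := μ)]
    congr 1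
    exact Set.eq_univ_of_forall fun ω S _ i j _ => h i j
  by_cases hL : ∃ k l : Fin L, k ≠ l
  · by_cases hN : 8 ≤ ∑ l, n l
    · exact one_sub_le_measure_noFalseConnections hp hd hU hΦ ha hlaw hind hΦa hc hJL hn haff hL hN
    by_cases hN0 : ∑ l, n l = 0
    · have hempty : IsEmpty (Σ l : Fin L, Fin (n l)) := by
        rw [← Fintype.card_eq_zero_iff]
        simpa using hN0
      rw [hsingle fun i => hempty.elim i]
      have : 0 ≤ 7 * ((∑ l, n l : ℕ) : ℝ)⁻¹ := by positivity
      linarith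
    · refine le_trans ?_ measureReal_nonneg
      have hpos : (0 : ℝ) < (∑ l, n l : ℕ) := by exact_mod_cast Nat.pos_of_ne_zero hN0
      have h7 : ((∑ l, n l : ℕ) : ℝ) ≤ 7 := by exact_mod_cast (by omega : ∑ l, n l ≤ 7)
      have : 1 ≤ 7 * ((∑ l, n l : ℕ) : ℝ)⁻¹ := by
        rw [← div_eq_mul_inv, one_le_div hpos]
        exact h7
      linarith
  · push Not at hL
    rw [hsingle fun i j => hL i.1 j.1]
    have : 0 ≤ 7 * ((∑ l, n l : ℕ) : ℝ)⁻¹ := by positivity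
    linarith
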